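/- **Setting.** Let $H=(V,E)$ be a hypergraph with $n$ vertices and $m\ge 1$ non-empty hyperedges, let $\Delta$ be the maximum vertex degree, $d$ the maximum size of a hyperedge and $\kappa=\sum_{v\in V}\deg(v)=\sum_{e\in E}|e|$. $H$ is given in shared memory by incidence lists ($E[v]$ for every vertex, the vertices of $e$ for every hyperedge, and their lengths), in any order; $\Delta$ and $d$ are known to the machine. A CREW PRAM is a synchronous machine with shared memory in which any number of processors may read a cell simultaneously but no two may write to the same cell in the same cycle. Time is the number of cycles, work is the total number of operations performed by the processors (idle processors do no work); drawing a uniform random number from $[0,1]$ takes $O(1)$ time, and all numbers drawn are independent. **Algorithm (CREW local-max).** Initialize $T[v]\gets\bot$ for all vertices; all vertices and hyperedges are active. While there are active hyperedges, perform a round: (1) every active $e$ draws a fresh random weight; (2) every active $v$ sets $T[v]$ to the active hyperedge of $E[v]$ with the greatest weight ($\bot$ if there is none), found by a tree MAX-reduction over $E[v]$; (3) every active $e$ computes $P_e=|\{v\in e: T[v]=e\}|$ by a tree SUM-reduction; if $P_e=|e|$, then $e$ is put into the matching and marked newly completed; (4) every active vertex contained in a newly completed hyperedge is marked newly completed; (5)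 every active $e$ determines by a tree OR-reduction whether it contains a newly completed vertex and, if so, becomes inactive; (6) newly completed vertices become inactive. The loop test is local: after each round, the processors of inactive hyperedges, of inactive vertices, and of vertices that found no active hyperedge in that round leave the loop. The algorithm halts when no processor is left. **Theorem.** (a) For every input and all outcomes of the random numbers, the algorithm never makes a concurrent write, and every round takes $O(1+\log\Delta+\log d)$ time and $O(\kappa+n)$ work, with absolute constants. (b) With high probability the algorithm halts, with all hyperedges inactive, after $O(1+\log m)$ rounds, and the whole run takes $O\big((1+\log\Delta+\log d)(1+\log m)\big)$ time and $O\big((\kappa+n)(1+\log m)\big)$ work. That is: for every $a>0$ there is a constant $C$, depending only on $a$, such that for every input all three bounds hold simultaneously, with $C$ as the constant, with probability at least $1-m^{-a}$. -/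

import Mathlib

open MeasureTheory ProbabilityTheory

noncomputable section

namespace CREW

/-! ### Hypergraphs and their incidence lists -/

/-- A hypergraph with `n` vertices and `m` (non-empty) hyperedges.  Parallel hyperedges are allowed. -/
structure Hypergraph (n m : ℕ) where
  edge : Fin m → Finset (Fin n)
  edge_nonempty : ∀ e, (edge e).Nonempty

namespace Hypergraph

variable {n m : ℕ} (H : Hypergraph n m)

/-- The set `E[v]` of hyperedges containing `v`. -/
def incident (v : Fin n) : Finset (Fin m) := Finset.univ.filter fun e => v ∈ H.edge e

/-- The degree of a vertex. -/
def degree (v : Fin n) : ℕ := (H.incident v).card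

/-- The maximum degree `Δ`. -/
def maxDegree : ℕ := Finset.univ.sup H.degree

/-- The rank `d`, the maximum size of a hyperedge. -/
def rank : ℕ := Finset.univ.sup fun e => (H.edge e).card

/-- The sum `κ` of all vertex degrees. -/
def kappa : ℕ := ∑ v, H.degree v

end Hypergraph

/-- The input representation: for every vertex a list of its hyperedges, and for every hyperedge
a list of its vertices, each in an arbitrary order and without repetition. -/
structure Lists {n m : ℕ} (H : Hypergraph n m) where
  edgesOf : Fin n → List (Fin m)
  vertsOf : Fin m → List (Fin n)
  edgesOf_nodup : ∀ v, (edgesOf v).Nodup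
  vertsOf_nodup : ∀ e, (vertsOf e).Nodup
  mem_edgesOf : ∀ v e, e ∈ edgesOf v ↔ v ∈ H.edge e
  mem_vertsOf : ∀ e v, v ∈ vertsOf e ↔ v ∈ H.edge e

/-! ### The CREW PRAM

A synchronous machine with a shared memory.  In every cycle each working processing element (PE)
performs one machine operation; the others are idle.  Time is the number of cycles, work is the
total number of operations performed.  Any number of PEs may read a cell at the same time, but two
PEs that write to the same cell in the same cycle make the computation fail. -/

/-- The kinds of PEs: one per vertex, one per hyperedge, one per entry of the list of a vertex,
and one per entry of the list of a hyperedge. -/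
inductive Kind
  | vertex | edge | vslot | eslot
  deriving DecidableEq

/-- A PE with its index.  Vertices and hyperedges have the identifiers `1, …, n` and `1, …, m`, and
`0` stands for "none".  The PE of a vertex or hyperedge `i` has index `(i, 0)`; the PE of entry `j`
(counted from `0`) in the list of `i` has index `(i, j)`. -/
@[ext] structure PE where
  kind : Kind
  i : ℕ
  j : ℕ
  deriving DecidableEq

/-- The arrays of natural numbers in shared memory (one-dimensional arrays use column `0` only).
* Input: `vlist[v, i]` and `elist[e, j]` are the entries of the incidence lists, `deg[v]` and
  `size[e]` their lengths.
* `top[v]`: the top hyperedge of a vertex.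
* `vInactive`, `eInactive`, `vNew`, `eNew`, `matched`: flags ("new" means newly completed).
* `vtmp`, `etmp`: scratch cells, one per list entry, for the reductions. -/
inductive Arr
  | vlist | elist | deg | size
  | top | vInactive | eInactive | vNew | eNew | matched
  | vtmp | etmp
  deriving DecidableEq

/-- The shared memory: the arrays `mem`, the weights `wt` of the hyperedges (by identifier), and
the number of calls of the random number generator so far. -/
structure State where
  mem : Arr → ℕ → ℕ → ℕ
  wt : ℕ → ℝ
  calls : ℕ

/-- Expressions that a PE evaluates.  Truth values are `0` and `1`. -/
inductive Exp
  | lit (k : ℕ)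
  | i
  | j
  | get (A : Arr) (a b : Exp)
  | add (a b : Exp)
  | mul (a b : Exp)
  | mod (a b : Exp)
  | eq (a b : Exp)
  | lt (a b : Exp)
  | or (a b : Exp)
  | heavier (a b : Exp)

/-- The value of an expression for the PE `p`.  Here `heavier a b` is that one of the hyperedges
`a` and `b` that has the greater weight. -/
def Exp.eval (s : State) (p : PE) : Exp → ℕ
  | .lit k => k
  | .i => p.i
  | .j => p.j
  | .get A a b => s.mem A (a.eval s p) (b.eval s p)
  | .add a b => a.eval s p + b.eval s p
  | .mul a b => a.eval s p * b.eval s p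
  | .mod a b => a.eval s p % b.eval s p
  | .eq a b => if a.eval s p = b.eval s p then 1 else 0
  | .lt a b => if a.eval s p < b.eval s p then 1 else 0
  | .or a b => if a.eval s p = 0 ∧ b.eval s p = 0 then 0 else 1
  | .heavier a b =>
      open Classical in if s.wt (a.eval s p) < s.wt (b.eval s p) then b.eval s p else a.eval s p

/-- The number of machine operations for evaluating an expression: one for each constant, read and
operator, and four for `heavier` (two reads, a comparison and a selection). -/
def Exp.cost : Exp → ℕ
  | .lit _ => 1
  | .i => 1
  | .j => 1
  | .get _ a b => a.cost + b.cost + 1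
  | .add a b => a.cost + b.cost + 1
  | .mul a b => a.cost + b.cost + 1
  | .mod a b => a.cost + b.cost + 1
  | .eq a b => a.cost + b.cost + 1
  | .lt a b => a.cost + b.cost + 1
  | .or a b => a.cost + b.cost + 1
  | .heavier a b => a.cost + b.cost + 4

/-- Programs, executed in lockstep by a set of PEs.
* `write A a b x`: every PE writes `x` to the cell `A[a, b]`.
* `rnd a`: every PE draws a fresh random number as the weight of `a`.
* `only k c`: the PEs of kind `k` execute `c`, the others are idle meanwhile.
* `cond g c`: every PE evaluates `g`; those with a non-zero result execute `c`, the others are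
  idle meanwhile. -/
inductive Code
  | skip
  | write (A : Arr) (a b x : Exp)
  | rnd (a : Exp)
  | seq (c₁ c₂ : Code)
  | only (k : Kind) (c : Code)
  | cond (g : Exp) (c : Code)

/-- A memory array after the PEs in `P` have simultaneously written the values `val` to the
addresses `addr` (which are distinct). -/
def writeAll {α β : Type} (P : Finset PE) (addr : PE → α) (val : PE → β) (old : α → β) (x : α) : β :=
  open Classical in if h : ∃ p ∈ P, addr p = x then val h.choose else old x

/-- The result of an execution: the new state, the number of cycles, the number of operations. -/
structure Outcome where
  st : State
  time : ℕ
  work : ℕ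

/-- Execution of a program by the PEs in `P`; `none` if there is a write conflict.  Each cell is
read before it is overwritten in a simultaneous write.  The `k`-th call of the random number
generator yields `ξ k p` for the PE `p`. -/
def exec (ξ : ℕ → PE → ℝ) : Code → Finset PE → State → Option Outcome
  | .skip, _, s => some ⟨s, 0, 0⟩
  | .write A a b x, P, s =>
      open Classical in
      if Set.InjOn (fun p => (a.eval s p, b.eval s p)) (P : Set PE) then
        some
          ⟨{ s with
              mem := Function.update s.mem A fun u v =>
                writeAll P (fun p => (a.eval s p, b.eval s p)) (fun p => x.eval s p)
                  (fun c => s.mem A c.1 c.2) (u, v) },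
            a.cost + b.cost + x.cost + 1,
            (a.cost + b.cost + x.cost + 1) * P.card⟩
      else none
  | .rnd a, P, s =>
      open Classical in
      if Set.InjOn (fun p => a.eval s p) (P : Set PE) then
        some
          ⟨{ s with
              wt := writeAll P (fun p => a.eval s p) (fun p => ξ s.calls p) s.wt
              calls := s.calls + 1 },
            a.cost + 2,
            (a.cost + 2) * P.card⟩
      else none
  | .seq c₁ c₂, P, s =>
      (exec ξ c₁ P s).bind fun r =>
        (exec ξ c₂ P r.st).map fun q => ⟨q.st, r.time + q.time, r.work + q.work⟩
  | .only k c, P, s => exec ξ c (P.filter fun p => p.kind = k) s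
  | .cond g c, P, s =>
      (exec ξ c (P.filter fun p => g.eval s p ≠ 0) s).map fun q =>
        ⟨q.st, (g.cost + 1) + q.time, (g.cost + 1) * P.card + q.work⟩

/-! ### The algorithm -/

/-- Read an entry of a one-dimensional array. -/
def get1 (A : Arr) (a : Exp) : Exp := .get A a (.lit 0)

/-- Write an entry of a one-dimensional array. -/
def write1 (A : Arr) (a x : Exp) : Code := .write A a (.lit 0) x

/-- Tree reduction with the associative operation `op` of the cells `S[i, 0], …, S[i, len - 1]`,
into `S[i, 0]`, by the PEs `(i, 0), …, (i, len - 1)`, simultaneously for all `i`: the levels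
`h, h + 1, …, h + L - 1`.  On level `h`, cell `j` is combined with cell `j + 2 ^ h` for all `j`
divisible by `2 ^ (h + 1)`.  A PE without a partner is idle from there on. -/
def reduce (S : Arr) (len : Exp) (op : Exp → Exp → Exp) : ℕ → ℕ → Code
  | 0, _ => .skip
  | L + 1, h =>
      .cond (.mul (.eq (.mod .j (.lit (2 ^ (h + 1)))) (.lit 0)) (.lt (.add .j (.lit (2 ^ h))) len))
        (.seq (.write S .i .j (op (.get S .i .j) (.get S .i (.add .j (.lit (2 ^ h))))))
          (reduce S len op L (h + 1)))

/-- Initialization: `T[v] ← ⊥` for all vertices. -/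
def initCode : Code := .only .vertex (write1 .top .i (.lit 0))

/-- Phase 1: random weights for the hyperedges. -/
def phase1 : Code := .only .edge (.rnd .i)

/-- Phase 2: every vertex finds its heaviest active hyperedge by a MAX-reduction. -/
def phase2 (LΔ : ℕ) : Code :=
  .seq
    (.only .vslot
      (.seq
        (.write .vtmp .i .j
          (.mul (.eq (get1 .eInactive (.get .vlist .i .j)) (.lit 0)) (.get .vlist .i .j)))
        (reduce .vtmp (get1 .deg .i) .heavier LΔ 0)))
    (.only .vertex
      (.cond (.eq (.eq (get1 .top .i) (get1 .vtmp .i)) (.lit 0)) (write1 .top .i (get1 .vtmp .i))))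

/-- Phase 3: every hyperedge counts by a SUM-reduction the vertices whose top hyperedge it is; if
all its vertices agree, it is put into the matching and is newly completed. -/
def phase3 (Ld : ℕ) : Code :=
  .seq
    (.only .eslot
      (.seq (.write .etmp .i .j (.eq (get1 .top (.get .elist .i .j)) .i))
        (reduce .etmp (get1 .size .i) .add Ld 0)))
    (.only .edge
      (.cond (.eq (get1 .etmp .i) (get1 .size .i))
        (.seq (write1 .matched .i (.lit 1)) (write1 .eNew .i (.lit 1)))))

/-- Phase 4: the vertices of newly completed hyperedges are marked as newly completed. -/
def phase4 : Code :=
  .only .vslot (.cond (get1 .eNew (.get .vlist .i .j)) (write1 .vNew .i (.lit 1)))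

/-- Phase 5: every hyperedge determines by an OR-reduction whether it contains a newly completed
vertex; if so, it becomes inactive. -/
def phase5 (Ld : ℕ) : Code :=
  .seq
    (.only .eslot
      (.seq (.write .etmp .i .j (get1 .vNew (.get .elist .i .j)))
        (reduce .etmp (get1 .size .i) .or Ld 0)))
    (.only .edge (.cond (get1 .etmp .i) (write1 .eInactive .i (.lit 1))))

/-- Phase 6: newly completed vertices become inactive. -/
def phase6 : Code := .only .vertex (.cond (get1 .vNew .i) (write1 .vInactive .i (.lit 1)))

/-- One round, where `LΔ` and `Ld` are the numbers of levels of the reductions. -/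
def roundCode (LΔ Ld : ℕ) : Code :=
  .seq phase1 (.seq (phase2 LΔ) (.seq (phase3 Ld) (.seq phase4 (.seq (phase5 Ld) phase6))))

/-- The condition under which a PE stays in the loop for another round: its hyperedge is active, or
its vertex is active and found an active hyperedge in this round.  So the PEs that take part in a
round are those of the active hyperedges and vertices, and no communication is needed for detecting
that no active hyperedges are left. -/
def stays : Kind → Exp
  | .edge => .eq (get1 .eInactive .i) (.lit 0)
  | .eslot => .eq (get1 .eInactive .i) (.lit 0)
  | .vertex => .mul (.eq (get1 .vInactive .i) (.lit 0)) (.lt (.lit 0) (get1 .top .i))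
  | .vslot => .mul (.eq (get1 .vInactive .i) (.lit 0)) (.lt (.lit 0) (get1 .top .i))

/-- The cost of the loop test of one PE. -/
def testCost (k : Kind) : ℕ := (stays k).cost + 1

/-- A configuration of the machine between two rounds: the memory, the PEs still in the loop, and
the time and work so far. -/
structure Config where
  st : State
  alive : Finset PE
  time : ℕ
  work : ℕ

/-- The loop body: a round followed by the loop test of every PE. -/
def loopBody (ξ : ℕ → PE → ℝ) (LΔ Ld : ℕ) (c : Config) : Option Config :=
  (exec ξ (roundCode LΔ Ld) c.alive c.st).map fun r =>
    ⟨r.st,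
      c.alive.filter fun p => (stays p.kind).eval r.st p ≠ 0,
      c.time + r.time + testCost .vertex + testCost .edge,
      c.work + r.work + ∑ p ∈ c.alive, testCost p.kind⟩

variable {n m : ℕ} {H : Hypergraph n m}

/-- All PEs for a given input: `n` for vertices, `m` for hyperedges, and `2κ` for list entries. -/
def allPEs (I : Lists H) : Finset PE :=
  (Finset.univ.image fun v : Fin n => (⟨.vertex, v + 1, 0⟩ : PE)) ∪
  (Finset.univ.image fun e : Fin m => (⟨.edge, e + 1, 0⟩ : PE)) ∪
  (Finset.univ.biUnion fun v : Fin n =>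
    (Finset.range (I.edgesOf v).length).image fun k => (⟨.vslot, v + 1, k⟩ : PE)) ∪
  (Finset.univ.biUnion fun e : Fin m =>
    (Finset.range (I.vertsOf e).length).image fun k => (⟨.eslot, e + 1, k⟩ : PE))

/-- The list of vertex number `a ∈ {1, …, n}`, as identifiers in `{1, …, m}`. -/
def Lists.vrow (I : Lists H) (a : ℕ) : List ℕ :=
  if h : 1 ≤ a ∧ a ≤ n then
    (I.edgesOf ⟨a - 1, by omega⟩).map fun e : Fin m => (e : ℕ) + 1 else []

/-- The list of hyperedge number `a ∈ {1, …, m}`, as identifiers in `{1, …, n}`. -/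
def Lists.erow (I : Lists H) (a : ℕ) : List ℕ :=
  if h : 1 ≤ a ∧ a ≤ m then
    (I.vertsOf ⟨a - 1, by omega⟩).map fun v : Fin n => (v : ℕ) + 1 else []

/-- The initial memory: the input arrays are filled in, everything else is cleared, and the weights
(in particular that of "none") have a value below all random numbers. -/
def initState (I : Lists H) : State where
  mem
    | .vlist, a, b => (I.vrow a).getD b 0
    | .elist, a, b => (I.erow a).getD b 0
    | .deg, a, b => if b = 0 then (I.vrow a).length else 0
    | .size, a, b => if b = 0 then (I.erow a).length else 0
    | _, _, _ => 0
  wt := fun _ => -1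
  calls := 0

/-- The configuration after the initialization and `k` rounds, with random numbers `ξ`; `none` if
there has been a write conflict.  The reductions have `⌈log₂ Δ⌉` and `⌈log₂ d⌉` levels. -/
def run (I : Lists H) (ξ : ℕ → PE → ℝ) : ℕ → Option Config
  | 0 => (exec ξ initCode (allPEs I) (initState I)).map fun r => ⟨r.st, allPEs I, r.time, r.work⟩
  | k + 1 => (run I ξ k).bind (loopBody ξ (Nat.clog 2 H.maxDegree) (Nat.clog 2 H.rank))

/-- The algorithm halts without write conflicts after at most `r` rounds, `t` cycles and `w`
operations in total: no PE is left in the loop, and all hyperedges are inactive. -/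
def HaltsWithin (I : Lists H) (ξ : ℕ → PE → ℝ) (r t w : ℝ) : Prop :=
  ∃ (k : ℕ) (c : Config), run I ξ k = some c ∧ c.alive = ∅ ∧
    (∀ e : Fin m, c.st.mem .eInactive (e + 1) 0 ≠ 0) ∧
    (k : ℝ) ≤ r ∧ (c.time : ℝ) ≤ t ∧ (c.work : ℝ) ≤ w

end CREW

end

/-!
Conflict freeness and the bounds for a single round hold for every choice of the random numbers.
Write conflicts are impossible in all instructions in which a PE writes to cells with its own index
(`exec_write_own`).  The only other one is the marking of vertices by their list entries, and it is
free of conflicts because a newly completed hyperedge is the top hyperedge of each of its vertices,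
whereas the vertices of hyperedges completed in former rounds have left the loop (`LoopInv`).  A tree
reduction takes a constant time per level, and on level `h` each working PE accounts for `2 ^ h` list
entries of its own, so the work of all levels is a geometric series (`exec_reduce`).

If in each round the weights of the hyperedges are distinct and non-negative, which is almost surely
the case, then the active hyperedges develop as in the local-max process on the conflict graph, whose
vertices are the hyperedges (`exists_run_simInv`): in each round the hyperedges that are heavier than
all active hyperedges in conflict with them are removed together with those in conflict with them.

The number of rounds is bounded with the number `A` of ordered conflicts among the active
hyperedges, each being in conflict with itself.  Let `D e` be the number of active hyperedges in
conflict with `e`.  For `f` in conflict with `e`, the hyperedge `f` is, by symmetry, heavier than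
everything else in conflict with `e` or `f` with probability at least `1 / (D e + D f)`.  For fixed
`e` these events are disjoint, and each of them removes `e` and its `D e` ordered conflicts `(e, g)`.
Hence the expected number of removed ordered conflicts is at least the sum of `D e / (D e + D f)`
over all ordered conflicts `(e, f)`, which is `A / 2` (`expected_conflicts_step`).  As the weights of
a round are independent of the past, the expectation of `A` after `k` rounds is at most
`m ^ 2 / 2 ^ k`, and by Markov's inequality this bounds the probability that a hyperedge is still
active (`measureReal_localMaxProcess_ne_empty_le`).
-/

namespace CREW

/-! ### Execution of single instructions -/

theorem writeAll_of_mem {α β : Type} {P : Finset PE} {addr : PE → α} (val : PE → β) (old : α → β)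
    (hinj : Set.InjOn addr (P : Set PE)) {p : PE} (hp : p ∈ P) :
    writeAll P addr val old (addr p) = val p := by
  have h : ∃ q ∈ P, addr q = addr p := ⟨p, hp, rfl⟩
  have hq := h.choose_spec
  unfold writeAll
  rw [dif_pos h, hinj hq.1 hp hq.2]

theorem writeAll_of_forall_ne {α β : Type} {P : Finset PE} {addr : PE → α} (val : PE → β)
    (old : α → β) {x : α} (hx : ∀ p ∈ P, addr p ≠ x) : writeAll P addr val old x = old x := by
  unfold writeAll
  rw [dif_neg]
  rintro ⟨p, hp, h⟩
  exact hx p hp h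

/-- The state `s` with array `A` replaced by `g`. -/
def State.setArr (s : State) (A : Arr) (g : ℕ → ℕ → ℕ) : State :=
  { s with mem := Function.update s.mem A g }

@[simp] theorem State.setArr_mem_self (s : State) (A : Arr) (g : ℕ → ℕ → ℕ) :
    (s.setArr A g).mem A = g := by simp [State.setArr]

@[simp] theorem State.setArr_mem_of_ne (s : State) {A B : Arr} (g : ℕ → ℕ → ℕ) (h : B ≠ A) :
    (s.setArr A g).mem B = s.mem B := by simp [State.setArr, h]

open Classical in
/-- PEs of one kind whose own index is the address of the written cell never conflict. -/
theorem exec_write_own (ξ : ℕ → PE → ℝ) (A : Arr) (b x : Exp) (K : Kind) (P : Finset PE) (s : State)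
    (hK : ∀ p ∈ P, p.kind = K) (hb : ∀ p ∈ P, b.eval s p = p.j) :
    exec ξ (.write A .i b x) P s = some
      ⟨s.setArr A fun u v => if (⟨K, u, v⟩ : PE) ∈ P then x.eval s ⟨K, u, v⟩ else s.mem A u v,
        b.cost + x.cost + 2, (b.cost + x.cost + 2) * P.card⟩ := by
  have hinj : Set.InjOn (fun p => (Exp.i.eval s p, b.eval s p)) (P : Set PE) := by
    intro p hp q hq h
    simp only [Exp.eval, Prod.mk.injEq] at h
    have hp' : p ∈ P := hp
    have hq' : q ∈ P := hq
    rw [hb p hp', hb q hq'] at h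
    exact PE.ext ((hK p hp').trans (hK q hq').symm) h.1 h.2
  have hc : Exp.i.cost + b.cost + x.cost + 1 = b.cost + x.cost + 2 := by simp [Exp.cost]; ring
  simp only [exec]
  rw [if_pos hinj, hc]
  congr 2
  unfold State.setArr
  congr 2
  funext u v
  split_ifs with h
  · have := writeAll_of_mem (fun p => x.eval s p) (fun c : ℕ × ℕ => s.mem A c.1 c.2) hinj h
    simpa [Exp.eval, hb _ h] using this
  · apply writeAll_of_forall_ne
    intro p hp hpe
    simp only [Exp.eval, Prod.mk.injEq] at hpe
    apply h
    have : p = ⟨K, u, v⟩ := PE.ext (hK p hp) hpe.1 ((hb p hp).symm.trans hpe.2)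
    exact this ▸ hp

theorem exec_seq {ξ : ℕ → PE → ℝ} {c₁ c₂ : Code} {P : Finset PE} {s : State} {r q : Outcome}
    (h₁ : exec ξ c₁ P s = some r) (h₂ : exec ξ c₂ P r.st = some q) :
    exec ξ (.seq c₁ c₂) P s = some ⟨q.st, r.time + q.time, r.work + q.work⟩ := by
  simp [exec, h₁, h₂]

theorem exec_only {ξ : ℕ → PE → ℝ} {k : Kind} {c : Code} {P : Finset PE} {s : State} {r : Outcome}
    (h : exec ξ c (P.filter fun p => p.kind = k) s = some r) :
    exec ξ (.only k c) P s = some r := by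
  rw [← h, exec]

theorem exec_cond {ξ : ℕ → PE → ℝ} {g : Exp} {c : Code} {P : Finset PE} {s : State} {q : Outcome}
    (h : exec ξ c (P.filter fun p => g.eval s p ≠ 0) s = some q) :
    exec ξ (.cond g c) P s =
      some ⟨q.st, (g.cost + 1) + q.time, (g.cost + 1) * P.card + q.work⟩ := by
  simp only [exec]
  rw [h]
  rfl

/-! ### Tree reductions -/

/-- On every level at most a `2 ^ (-h)` fraction of the list entries has a working PE: the PE of
entry `j` accounts for the `2 ^ h` entries starting at `j`. -/
theorem card_level_mul_le {K : Kind} {X : ℕ → Prop} {ℓ : ℕ → ℕ} {h : ℕ} {P P₀ : Finset PE}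
    (hP : ∀ p ∈ P, p.kind = K ∧ X p.i ∧ 2 ^ h ∣ p.j ∧ p.j + 2 ^ h ≤ ℓ p.i)
    (hP₀ : ∀ i j, X i → j < ℓ i → (⟨K, i, j⟩ : PE) ∈ P₀) :
    P.card * 2 ^ h ≤ P₀.card := by
  have : (P ×ˢ Finset.range (2 ^ h)).card ≤ P₀.card := by
    apply Finset.card_le_card_of_injOn (fun q => (⟨K, q.1.i, q.1.j + q.2⟩ : PE))
    · rintro ⟨p, t⟩ hq
      simp only [Finset.coe_product, Set.mem_prod, Finset.mem_coe, Finset.mem_range] at hq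
      obtain ⟨-, h2, -, h4⟩ := hP p hq.1
      exact hP₀ _ _ h2 (by dsimp only; omega)
    · rintro ⟨p, t⟩ hq ⟨p', t'⟩ hq' heq
      simp only [Finset.coe_product, Set.mem_prod, Finset.mem_coe, Finset.mem_range] at hq hq'
      simp only [PE.mk.injEq, true_and] at heq
      obtain ⟨h1, -, ⟨a, ha⟩, -⟩ := hP p hq.1
      obtain ⟨h1', -, ⟨a', ha'⟩, -⟩ := hP p' hq'.1
      have key : a = a' := by
        have e1 : (2 ^ h * a + t) / 2 ^ h = a := by
          rw [Nat.mul_add_div (by positivity), Nat.div_eq_of_lt hq.2, add_zero]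
        have e2 : (2 ^ h * a' + t') / 2 ^ h = a' := by
          rw [Nat.mul_add_div (by positivity), Nat.div_eq_of_lt hq'.2, add_zero]
        rw [← e1, ← e2, ← ha, ← ha', heq.2]
      have hj : p.j = p'.j := by rw [ha, ha', key]
      have hpp : p = p' := PE.ext (h1.trans h1'.symm) heq.1 hj
      have htt : t = t' := by have := heq.2; omega
      rw [hpp, htt]
  simpa using this

/-- The guard of level `h` of a tree reduction. -/
def levelGuard (len : Exp) (h : ℕ) : Exp :=
  .mul (.eq (.mod .j (.lit (2 ^ (h + 1)))) (.lit 0)) (.lt (.add .j (.lit (2 ^ h))) len)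

theorem levelGuard_eval_ne_zero (len : Exp) (h : ℕ) (s : State) (p : PE) :
    (levelGuard len h).eval s p ≠ 0 ↔ 2 ^ (h + 1) ∣ p.j ∧ p.j + 2 ^ h < len.eval s p := by
  change (if p.j % 2 ^ (h + 1) = 0 then 1 else 0) * (if p.j + 2 ^ h < len.eval s p then 1 else 0)
    ≠ 0 ↔ _
  rw [Nat.dvd_iff_mod_eq_zero, mul_ne_zero_iff, ite_ne_right_iff, ite_ne_right_iff]
  exact and_congr (and_iff_left one_ne_zero) (and_iff_left one_ne_zero)

theorem levelGuard_cost (len : Exp) (h : ℕ) : (levelGuard len h).cost = len.cost + 10 := by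
  simp only [levelGuard, Exp.cost]; ring

/-- Correctness, time and work of the levels `h, …, h + L - 1` of a tree reduction.  The relation
`R i a b x` says that `x` is a correct result for the entries `a, …, b - 1` of row `i`, so that
associativity of the operation is only needed in the form `hR`; in particular ties in a
MAX-reduction may be broken in any way.  A level costs at most `14` operations for the guard and `15`
for combining two cells, and `P₀` are the PEs of all list entries. -/
theorem exec_reduce (ξ : ℕ → PE → ℝ) {S : Arr} {len : Exp} {op : Exp → Exp → Exp} {K : Kind}
    {X : ℕ → Prop} {ℓ : ℕ → ℕ} {f : ℕ → ℕ → ℕ} {R : ℕ → ℕ → ℕ → ℕ → Prop}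
    {wt₀ : ℕ → ℝ} {mem₀ : Arr → ℕ → ℕ → ℕ} {P₀ : Finset PE}
    (hlen : ∀ s : State, (∀ A, A ≠ S → s.mem A = mem₀ A) → ∀ p, len.eval s p = ℓ p.i)
    (hlenc : len.cost ≤ 3)
    (hop : ∀ (s : State) p a b, s.wt = wt₀ → (op a b).eval s p = f (a.eval s p) (b.eval s p))
    (hopc : ∀ a b, (op a b).cost ≤ a.cost + b.cost + 4)
    (hR : ∀ i a b c u v, R i a b u → R i b c v → R i a c (f u v))
    (hP₀ : ∀ i j, X i → j < ℓ i → (⟨K, i, j⟩ : PE) ∈ P₀) (L : ℕ) :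
    ∀ (h : ℕ) (P : Finset PE) (s : State), (∀ A, A ≠ S → s.mem A = mem₀ A) → s.wt = wt₀ →
      (∀ p ∈ P, p.kind = K ∧ X p.i) →
      (∀ i j, X i → 2 ^ (h + 1) ∣ j → j + 2 ^ h < ℓ i → (⟨K, i, j⟩ : PE) ∈ P) →
      (∀ i j, X i → 2 ^ h ∣ j → j < ℓ i → R i j (min (j + 2 ^ h) (ℓ i)) (s.mem S i j)) →
      (∀ i, X i → ℓ i ≤ 2 ^ (h + L)) →
      ∃ r, exec ξ (reduce S len op L h) P s = some r ∧ r.time ≤ 29 * L ∧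
        r.work * 2 ^ h ≤ 14 * P.card * 2 ^ h + 58 * P₀.card ∧
        (∀ A, A ≠ S → r.st.mem A = mem₀ A) ∧ r.st.wt = wt₀ ∧ r.st.calls = s.calls ∧
        (∀ u v, (⟨K, u, v⟩ : PE) ∉ P → r.st.mem S u v = s.mem S u v) ∧
        (∀ i, X i → 0 < ℓ i → R i 0 (ℓ i) (r.st.mem S i 0)) := by
  induction L with
  | zero =>
    intro h P s hm hw hP hP' hS hL
    refine ⟨⟨s, 0, 0⟩, rfl, by simp, by simp, hm, hw, rfl, fun _ _ _ => rfl, ?_⟩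
    intro i hi hpos
    have h1 := hS i 0 hi (dvd_zero _) hpos
    have h2 := hL i hi
    rwa [min_eq_right (by simpa using h2)] at h1
  | succ L ih =>
    -- the arithmetic of time and work, with costs and cardinalities as variables
    have hT : ∀ gc xc t : ℕ, gc + 1 ≤ 14 → xc ≤ 12 → t ≤ 29 * L →
        gc + 1 + (1 + xc + 2 + t) ≤ 29 * (L + 1) := by omega
    have hW : ∀ gc xc p p' w z N : ℕ, (gc + 1) * (p * z) ≤ 14 * (p * z) →
        (1 + xc + 2) * (p' * z) ≤ 15 * N → w * (z + z) ≤ 14 * p' * (z + z) + 58 * N →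
        p' * z ≤ N → ((gc + 1) * p + ((1 + xc + 2) * p' + w)) * z ≤ 14 * p * z + 58 * N := by
      intros; linarith
    intro h P s hm hw hP hP' hS hL
    set g : Exp := levelGuard len h with hg
    have hgeval : ∀ p, g.eval s p ≠ 0 ↔ 2 ^ (h + 1) ∣ p.j ∧ p.j + 2 ^ h < ℓ p.i := by
      intro p; rw [hg, levelGuard_eval_ne_zero, hlen s hm]
    have hgc : g.cost + 1 ≤ 14 := by rw [hg, levelGuard_cost]; omega
    set P' := P.filter fun p => g.eval s p ≠ 0 with hP'def
    have hmem : ∀ p, p ∈ P' ↔ p ∈ P ∧ 2 ^ (h + 1) ∣ p.j ∧ p.j + 2 ^ h < ℓ p.i := by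
      intro p; rw [hP'def, Finset.mem_filter, hgeval]
    set x : Exp := op (.get S .i .j) (.get S .i (.add .j (.lit (2 ^ h)))) with hx
    have hxc : x.cost ≤ 12 := hopc (.get S .i .j) (.get S .i (.add .j (.lit (2 ^ h))))
    have hxe : ∀ p, x.eval s p = f (s.mem S p.i p.j) (s.mem S p.i (p.j + 2 ^ h)) := by
      intro p; rw [hx, hop s p _ _ hw]; rfl
    have hwr := exec_write_own ξ S .j x K P' s (fun p hp => (hP p ((hmem p).1 hp).1).1)
      (fun _ _ => rfl)
    set s' := s.setArr S fun u v =>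
      open Classical in
      if (⟨K, u, v⟩ : PE) ∈ P' then x.eval s ⟨K, u, v⟩ else s.mem S u v with hs'
    have hs'S : ∀ u v, s'.mem S u v =
        open Classical in
        if (⟨K, u, v⟩ : PE) ∈ P' then f (s.mem S u v) (s.mem S u (v + 2 ^ h)) else s.mem S u v := by
      intro u v
      simp only [hs', State.setArr_mem_self, hxe]
    have hpow : 2 ^ (h + 1) = 2 ^ h + 2 ^ h := by ring
    obtain ⟨r, hr, ht, hwk, hrm, hrw, hrc, hru, hrR⟩ := ih (h + 1) P' s'
      (fun A hA => by rw [hs', State.setArr_mem_of_ne _ _ hA, hm A hA]) (by rw [hs']; exact hw)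
      (fun p hp => hP p ((hmem p).1 hp).1)
      (by
        intro i j hi hd hj
        have hd' : 2 ^ (h + 1) ∣ j := (pow_dvd_pow 2 (Nat.le_succ _)).trans hd
        refine (hmem _).2 ⟨hP' i j hi hd' (by omega), hd', by dsimp only; omega⟩)
      (by
        intro i j hi hd hj
        have hd0 : 2 ^ h ∣ j := (pow_dvd_pow 2 (Nat.le_succ _)).trans hd
        rw [hs'S]
        -- a cell without a partner already covers the rest of its row
        by_cases hj2 : j + 2 ^ h < ℓ i
        · rw [if_pos ((hmem _).2 ⟨hP' i j hi hd hj2, hd, hj2⟩)]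
          have h1 := hS i j hi hd0 hj
          have h2 := hS i (j + 2 ^ h) hi (hd0.add dvd_rfl) hj2
          rw [min_eq_left hj2.le] at h1
          have := hR i _ _ _ _ _ h1 h2
          rwa [add_assoc, ← hpow] at this
        · rw [if_neg (fun hmem' => hj2 ((hmem _).1 hmem').2.2)]
          have h1 := hS i j hi hd0 hj
          rw [min_eq_right (by omega)] at h1 ⊢
          exact h1)
      (by intro i hi; have := hL i hi; rwa [show h + 1 + L = h + (L + 1) by ring])
    have hcard : P'.card * 2 ^ h ≤ P₀.card := by
      refine card_level_mul_le (X := X) (ℓ := ℓ) (fun p hp => ?_) hP₀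
      have h1 := (hmem p).1 hp
      have h2 := hP p h1.1
      exact ⟨h2.1, h2.2, (pow_dvd_pow 2 (Nat.le_succ _)).trans h1.2.1, h1.2.2.le⟩
    have hex := exec_cond (g := g) (exec_seq hwr hr)
    refine ⟨_, hex, ?_, ?_, hrm, hrw, ?_, ?_, hrR⟩
    · change g.cost + 1 + (1 + x.cost + 2 + r.time) ≤ _
      exact hT _ _ _ hgc hxc ht
    · change ((g.cost + 1) * P.card + ((1 + x.cost + 2) * P'.card + r.work)) * 2 ^ h ≤ _
      have e1 : (g.cost + 1) * (P.card * 2 ^ h) ≤ 14 * (P.card * 2 ^ h) := Nat.mul_le_mul_right _ hgc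
      have e2 : (1 + x.cost + 2) * (P'.card * 2 ^ h) ≤ 15 * P₀.card :=
        Nat.mul_le_mul (by omega) hcard
      exact hW _ _ _ _ _ _ _ e1 e2 (hpow ▸ hwk) hcard
    · rw [hrc]; rfl
    · intro u v huv
      have : (⟨K, u, v⟩ : PE) ∉ P' := fun hh => huv ((hmem _).1 hh).1
      rw [hru u v this, hs'S, if_neg this]

variable {n m : ℕ} {H : Hypergraph n m}

/-! ### Incidence lists and the PEs in the loop -/

theorem Lists.mem_vrow (I : Lists H) {v e : ℕ} :
    e ∈ I.vrow v ↔ ∃ (u : Fin n) (f : Fin m), v = u + 1 ∧ e = f + 1 ∧ u ∈ H.edge f := by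
  unfold Lists.vrow
  split_ifs with h
  · simp only [List.mem_map, I.mem_edgesOf]
    constructor
    · rintro ⟨f, hf, rfl⟩
      exact ⟨_, f, by simp only; omega, rfl, hf⟩
    · rintro ⟨u, f, rfl, rfl, huf⟩
      exact ⟨f, by simpa using huf, rfl⟩
  · simp only [List.not_mem_nil, false_iff]
    rintro ⟨u, f, rfl, -, -⟩
    omega

theorem Lists.mem_erow (I : Lists H) {v e : ℕ} :
    v ∈ I.erow e ↔ ∃ (u : Fin n) (f : Fin m), v = u + 1 ∧ e = f + 1 ∧ u ∈ H.edge f := by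
  unfold Lists.erow
  split_ifs with h
  · simp only [List.mem_map, I.mem_vertsOf]
    constructor
    · rintro ⟨u, hf, rfl⟩
      exact ⟨u, ⟨e - 1, by omega⟩, rfl, by simp only; omega, hf⟩
    · rintro ⟨u, f, rfl, rfl, huf⟩
      exact ⟨u, by simpa using huf, rfl⟩
  · simp only [List.not_mem_nil, false_iff]
    rintro ⟨u, f, -, rfl, -⟩
    omega

theorem Lists.mem_erow_iff (I : Lists H) {v e : ℕ} : v ∈ I.erow e ↔ e ∈ I.vrow v := by
  rw [I.mem_erow, I.mem_vrow]

theorem Lists.bounds_of_mem_vrow (I : Lists H) {v e : ℕ} (h : e ∈ I.vrow v) :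
    (1 ≤ v ∧ v ≤ n) ∧ 1 ≤ e ∧ e ≤ m := by
  obtain ⟨u, f, rfl, rfl, -⟩ := I.mem_vrow.1 h
  omega

theorem Lists.vrow_nodup (I : Lists H) (v : ℕ) : (I.vrow v).Nodup := by
  unfold Lists.vrow
  split_ifs with h
  · exact (I.edgesOf_nodup _).map fun a b hab => by simpa [Fin.ext_iff] using hab
  · exact List.nodup_nil

theorem Lists.length_edgesOf (I : Lists H) (v : Fin n) : (I.edgesOf v).length = H.degree v := by
  have : (I.edgesOf v).toFinset = H.incident v := by
    ext e; simp [I.mem_edgesOf, Hypergraph.incident]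
  rw [Hypergraph.degree, ← this, List.toFinset_card_of_nodup (I.edgesOf_nodup v)]

theorem Lists.length_vertsOf (I : Lists H) (e : Fin m) :
    (I.vertsOf e).length = (H.edge e).card := by
  have : (I.vertsOf e).toFinset = H.edge e := by
    ext v; simp [I.mem_vertsOf]
  rw [← this, List.toFinset_card_of_nodup (I.vertsOf_nodup e)]

theorem Lists.length_vrow_le (I : Lists H) (v : ℕ) : (I.vrow v).length ≤ H.maxDegree := by
  unfold Lists.vrow
  split_ifs with h
  · rw [List.length_map, I.length_edgesOf]
    exact Finset.le_sup (f := H.degree) (Finset.mem_univ _)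
  · simp

theorem Lists.length_erow_le (I : Lists H) (e : ℕ) : (I.erow e).length ≤ H.rank := by
  unfold Lists.erow
  split_ifs with h
  · rw [List.length_map, I.length_vertsOf]
    exact Finset.le_sup (f := fun e => (H.edge e).card) (Finset.mem_univ _)
  · simp

theorem Lists.length_erow_pos (I : Lists H) {e : ℕ} (h : 1 ≤ e ∧ e ≤ m) :
    0 < (I.erow e).length := by
  unfold Lists.erow
  rw [dif_pos h, List.length_map, I.length_vertsOf]
  exact (H.edge_nonempty _).card_pos

theorem Hypergraph.sum_card_edge (H : Hypergraph n m) : ∑ e, (H.edge e).card = H.kappa := by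
  simp only [Hypergraph.kappa, Hypergraph.degree, Hypergraph.incident, Finset.card_filter]
  rw [Finset.sum_comm]
  simp

theorem Hypergraph.card_le_kappa (H : Hypergraph n m) : m ≤ H.kappa := by
  rw [← H.sum_card_edge]
  calc m = ∑ _e : Fin m, 1 := by simp
    _ ≤ _ := Finset.sum_le_sum fun e _ => (H.edge_nonempty e).card_pos

/-- The index range of the PEs of each kind. -/
def Lists.IsIndex (I : Lists H) (p : PE) : Prop :=
  match p.kind with
  | .vertex => (1 ≤ p.i ∧ p.i ≤ n) ∧ p.j = 0
  | .edge => (1 ≤ p.i ∧ p.i ≤ m) ∧ p.j = 0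
  | .vslot => p.j < (I.vrow p.i).length
  | .eslot => p.j < (I.erow p.i).length

theorem mem_allPEs (I : Lists H) (p : PE) : p ∈ allPEs I ↔ I.IsIndex p := by
  obtain ⟨K, i, j⟩ := p
  cases K
  · simp only [allPEs, Lists.IsIndex, Finset.mem_union, Finset.mem_image, Finset.mem_univ,
      Finset.mem_biUnion, PE.mk.injEq, true_and, reduceCtorEq, false_and, and_false, exists_false,
      or_false]
    constructor
    · rintro ⟨a, rfl, rfl⟩; omega
    · rintro ⟨h, rfl⟩; exact ⟨⟨i - 1, by omega⟩, by simp only; omega, rfl⟩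
  · simp only [allPEs, Lists.IsIndex, Finset.mem_union, Finset.mem_image, Finset.mem_univ,
      Finset.mem_biUnion, PE.mk.injEq, true_and, reduceCtorEq, false_and, and_false, exists_false,
      or_false, false_or]
    constructor
    · rintro ⟨a, rfl, rfl⟩; omega
    · rintro ⟨h, rfl⟩; exact ⟨⟨i - 1, by omega⟩, by simp only; omega, rfl⟩
  · simp only [allPEs, Lists.IsIndex, Finset.mem_union, Finset.mem_image, Finset.mem_univ,
      Finset.mem_biUnion, PE.mk.injEq, true_and, reduceCtorEq, false_and, and_false, exists_false,
      or_false, false_or, Finset.mem_range]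
    constructor
    · rintro ⟨a, k, hk, rfl, rfl⟩
      simpa [Lists.vrow] using hk
    · intro h
      unfold Lists.vrow at h
      split_ifs at h with h'
      · exact ⟨⟨i - 1, by omega⟩, j, by simpa using h, by simp only; omega, rfl⟩
      · simp at h
  · simp only [allPEs, Lists.IsIndex, Finset.mem_union, Finset.mem_image, Finset.mem_univ,
      Finset.mem_biUnion, PE.mk.injEq, true_and, reduceCtorEq, false_and, and_false, exists_false,
      false_or, Finset.mem_range]
    constructor
    · rintro ⟨a, k, hk, rfl, rfl⟩
      simpa [Lists.erow] using hk
    · intro h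
      unfold Lists.erow at h
      split_ifs at h with h'
      · exact ⟨⟨i - 1, by omega⟩, j, by simpa using h, by simp only; omega, rfl⟩
      · simp at h

theorem card_allPEs_le (I : Lists H) : (allPEs I).card ≤ 3 * (H.kappa + n) := by
  have h1 : (Finset.univ.image fun v : Fin n => (⟨.vertex, v + 1, 0⟩ : PE)).card ≤ n := by
    simpa using Finset.card_image_le (s := (Finset.univ : Finset (Fin n)))
      (f := fun v : Fin n => (⟨.vertex, v + 1, 0⟩ : PE))
  have h2 : (Finset.univ.image fun e : Fin m => (⟨.edge, e + 1, 0⟩ : PE)).card ≤ m := by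
    simpa using Finset.card_image_le (s := (Finset.univ : Finset (Fin m)))
      (f := fun e : Fin m => (⟨.edge, e + 1, 0⟩ : PE))
  have h3 : (Finset.univ.biUnion fun v : Fin n => (Finset.range (I.edgesOf v).length).image
      fun k => (⟨.vslot, v + 1, k⟩ : PE)).card ≤ H.kappa := by
    refine Finset.card_biUnion_le.trans (Finset.sum_le_sum fun v _ => ?_)
    rw [← I.length_edgesOf]
    simpa using Finset.card_image_le (s := Finset.range (I.edgesOf v).length)
      (f := fun k => (⟨.vslot, v + 1, k⟩ : PE))
  have h4 : (Finset.univ.biUnion fun e : Fin m => (Finset.range (I.vertsOf e).length).image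
      fun k => (⟨.eslot, e + 1, k⟩ : PE)).card ≤ H.kappa := by
    rw [← H.sum_card_edge]
    refine Finset.card_biUnion_le.trans (Finset.sum_le_sum fun e _ => ?_)
    rw [← I.length_vertsOf]
    simpa using Finset.card_image_le (s := Finset.range (I.vertsOf e).length)
      (f := fun k => (⟨.eslot, e + 1, k⟩ : PE))
  have h5 := H.card_le_kappa
  have h6 : (allPEs I).card ≤ n + m + H.kappa + H.kappa :=
    (Finset.card_union_le _ _).trans (add_le_add ((Finset.card_union_le _ _).trans
      (add_le_add ((Finset.card_union_le _ _).trans (add_le_add h1 h2)) h3)) h4)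
  omega

/-- Whether the vertex or hyperedge that a PE works for is among those in `av` or `ae`. -/
def PE.Owned (av ae : ℕ → Prop) (p : PE) : Prop :=
  match p.kind with
  | .vertex | .vslot => av p.i
  | .edge | .eslot => ae p.i

open Classical in
/-- The PEs of the vertices in `av` and of the hyperedges in `ae`.  Between rounds the set of PEs
in the loop always has this form: the PE of a vertex and those of its list entries leave the loop
together. -/
noncomputable def loopPEs (I : Lists H) (av ae : ℕ → Prop) : Finset PE := (allPEs I).filter (PE.Owned av ae)

variable {I : Lists H} {av ae : ℕ → Prop} {p : PE}

theorem mem_loopPEs : p ∈ loopPEs I av ae ↔ I.IsIndex p ∧ p.Owned av ae := by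
  simp only [loopPEs, Finset.mem_filter, mem_allPEs]

theorem mem_vertexPEs : p ∈ ((loopPEs I av ae).filter fun p => p.kind = .vertex) ↔
    p.kind = .vertex ∧ ((1 ≤ p.i ∧ p.i ≤ n) ∧ p.j = 0) ∧ av p.i := by
  obtain ⟨K, i, j⟩ := p
  rw [Finset.mem_filter, mem_loopPEs]
  cases K <;> simp [Lists.IsIndex, PE.Owned]

theorem mem_edgePEs : p ∈ ((loopPEs I av ae).filter fun p => p.kind = .edge) ↔
    p.kind = .edge ∧ ((1 ≤ p.i ∧ p.i ≤ m) ∧ p.j = 0) ∧ ae p.i := by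
  obtain ⟨K, i, j⟩ := p
  rw [Finset.mem_filter, mem_loopPEs]
  cases K <;> simp [Lists.IsIndex, PE.Owned]

theorem mem_vslotPEs : p ∈ ((loopPEs I av ae).filter fun p => p.kind = .vslot) ↔
    p.kind = .vslot ∧ av p.i ∧ p.j < (I.vrow p.i).length := by
  obtain ⟨K, i, j⟩ := p
  rw [Finset.mem_filter, mem_loopPEs]
  cases K <;> simp [Lists.IsIndex, PE.Owned, and_comm]

theorem mem_eslotPEs : p ∈ ((loopPEs I av ae).filter fun p => p.kind = .eslot) ↔
    p.kind = .eslot ∧ ae p.i ∧ p.j < (I.erow p.i).length := by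
  obtain ⟨K, i, j⟩ := p
  rw [Finset.mem_filter, mem_loopPEs]
  cases K <;> simp [Lists.IsIndex, PE.Owned, and_comm]

/-- The arrays that hold the input. -/
def Arr.IsInput (A : Arr) : Prop := A = .vlist ∨ A = .elist ∨ A = .deg ∨ A = .size

/-- The input arrays are intact. -/
def HasInput (I : Lists H) (s : State) : Prop := ∀ A : Arr, A.IsInput → s.mem A = (initState I).mem A

theorem HasInput.mono {s s' : State} (h : HasInput I s)
    (hs : ∀ A : Arr, A.IsInput → s'.mem A = s.mem A) : HasInput I s' :=
  fun A hA => (hs A hA).trans (h A hA)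

theorem HasInput.vlist {s : State} (h : HasInput I s) (a b : ℕ) :
    s.mem .vlist a b = (I.vrow a).getD b 0 := by rw [h .vlist (by simp [Arr.IsInput])]; rfl

theorem HasInput.elist {s : State} (h : HasInput I s) (a b : ℕ) :
    s.mem .elist a b = (I.erow a).getD b 0 := by rw [h .elist (by simp [Arr.IsInput])]; rfl

theorem HasInput.deg {s : State} (h : HasInput I s) (a : ℕ) :
    s.mem .deg a 0 = (I.vrow a).length := by rw [h .deg (by simp [Arr.IsInput])]; rfl

theorem HasInput.size {s : State} (h : HasInput I s) (a : ℕ) :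
    s.mem .size a 0 = (I.erow a).length := by rw [h .size (by simp [Arr.IsInput])]; rfl

/-! ### The phases of a round -/

open Classical in
theorem exec_write1_own (ξ : ℕ → PE → ℝ) (A : Arr) (x : Exp) (K : Kind) (P : Finset PE) (s : State)
    (hP : ∀ p ∈ P, p.kind = K ∧ p.j = 0) :
    exec ξ (write1 A .i x) P s = some
      ⟨s.setArr A fun u v => if (⟨K, u, v⟩ : PE) ∈ P then x.eval s ⟨K, u, v⟩ else s.mem A u v,
        x.cost + 3, (x.cost + 3) * P.card⟩ := by
  have := exec_write_own ξ A (.lit 0) x K P s (fun p hp => (hP p hp).1)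
    (fun p hp => (hP p hp).2.symm)
  rw [show (Exp.lit 0).cost + x.cost + 2 = x.cost + 3 by simp only [Exp.cost]; ring] at this
  exact this

/-- The list PEs of all rows in `X` initialize their scratch cells and reduce them. -/
theorem exec_slots (ξ : ℕ → PE → ℝ) {S : Arr} {x len : Exp} {op : Exp → Exp → Exp} {K : Kind}
    {X : ℕ → Prop} {ℓ : ℕ → ℕ} {f : ℕ → ℕ → ℕ} {R : ℕ → ℕ → ℕ → ℕ → Prop} {P : Finset PE}
    {s : State} {L : ℕ}
    (hP : ∀ p : PE, p ∈ P ↔ p.kind = K ∧ X p.i ∧ p.j < ℓ p.i)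
    (hlen : ∀ s' : State, (∀ A, A ≠ S → s'.mem A = s.mem A) → ∀ p, len.eval s' p = ℓ p.i)
    (hlenc : len.cost ≤ 3)
    (hop : ∀ (s' : State) p a b, s'.wt = s.wt → (op a b).eval s' p = f (a.eval s' p) (b.eval s' p))
    (hopc : ∀ a b, (op a b).cost ≤ a.cost + b.cost + 4)
    (hR1 : ∀ i j, X i → j < ℓ i → R i j (j + 1) (x.eval s ⟨K, i, j⟩))
    (hR : ∀ i a b c u v, R i a b u → R i b c v → R i a c (f u v))
    (hL : ∀ i, ℓ i ≤ 2 ^ L) :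
    ∃ r, exec ξ (.seq (.write S .i .j x) (reduce S len op L 0)) P s = some r ∧
      r.time ≤ 29 * L + x.cost + 3 ∧ r.work ≤ (x.cost + 75) * P.card ∧
      (∀ A, A ≠ S → r.st.mem A = s.mem A) ∧ r.st.wt = s.wt ∧ r.st.calls = s.calls ∧
      (∀ u v, (⟨K, u, v⟩ : PE) ∉ P → r.st.mem S u v = s.mem S u v) ∧
      (∀ i, X i → 0 < ℓ i → R i 0 (ℓ i) (r.st.mem S i 0)) := by
  have hwr := exec_write_own ξ S .j x K P s (fun p hp => ((hP p).1 hp).1) (fun _ _ => rfl)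
  set s₁ := s.setArr S fun u v =>
    open Classical in
    if (⟨K, u, v⟩ : PE) ∈ P then x.eval s ⟨K, u, v⟩ else s.mem S u v with hs₁
  obtain ⟨r, hr, ht, hw, hrm, hrw, hrc, hru, hrR⟩ := exec_reduce ξ (X := X) (ℓ := ℓ) (f := f)
    (R := R) (K := K) (P₀ := P) hlen hlenc hop hopc hR (fun i j hi hj => (hP _).2 ⟨rfl, hi, hj⟩)
    L 0 P s₁ (fun A hA => State.setArr_mem_of_ne s _ hA) rfl
    (fun p hp => ⟨((hP p).1 hp).1, ((hP p).1 hp).2.1⟩)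
    (fun i j hi _ hj => (hP _).2 ⟨rfl, hi, by dsimp only; omega⟩)
    (fun i j hi _ hj => by
      rw [hs₁, State.setArr_mem_self, if_pos ((hP _).2 ⟨rfl, hi, hj⟩), pow_zero, min_eq_left hj]
      exact hR1 i j hi hj)
    (fun i _ => by simpa using hL i)
  refine ⟨_, exec_seq hwr hr, ?_, ?_, hrm, hrw, hrc, ?_, hrR⟩
  · change Exp.j.cost + x.cost + 2 + r.time ≤ _
    have : Exp.j.cost = 1 := rfl
    omega
  · change (Exp.j.cost + x.cost + 2) * P.card + r.work ≤ _
    have : Exp.j.cost = 1 := rfl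
    rw [this]
    simp only [pow_zero, mul_one] at hw
    linarith
  · intro u v huv
    rw [hru u v huv, hs₁, State.setArr_mem_self, if_neg huv]

open Classical in
theorem exec_phase1 (ξ : ℕ → PE → ℝ) (I : Lists H) (av ae : ℕ → Prop) (s : State) :
    ∃ r, exec ξ phase1 (loopPEs I av ae) s = some r ∧
      r.time ≤ 3 ∧ r.work ≤ 3 * (loopPEs I av ae).card ∧
      r.st.mem = s.mem ∧ r.st.calls = s.calls + 1 ∧
      ∀ e, r.st.wt e = if (1 ≤ e ∧ e ≤ m) ∧ ae e then ξ s.calls ⟨.edge, e, 0⟩ else s.wt e := by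
  set P := (loopPEs I av ae).filter fun p => p.kind = .edge with hP
  have hinj : Set.InjOn (fun p => Exp.i.eval s p) (P : Set PE) := by
    intro p hp q hq h
    have hp' := mem_edgePEs.1 (Finset.mem_coe.1 hp)
    have hq' := mem_edgePEs.1 (Finset.mem_coe.1 hq)
    exact PE.ext (hp'.1.trans hq'.1.symm) h (hp'.2.1.2.trans hq'.2.1.2.symm)
  refine ⟨⟨⟨s.mem, writeAll P (fun p => Exp.i.eval s p) (fun p => ξ s.calls p) s.wt, s.calls + 1⟩,
    3, 3 * P.card⟩, ?_, le_rfl, Nat.mul_le_mul_left _ (Finset.card_filter_le _ _), rfl, rfl, ?_⟩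
  · simp only [phase1, exec]
    rw [if_pos hinj]
    rfl
  · intro e
    dsimp only
    split_ifs with h
    · exact writeAll_of_mem (fun p => ξ s.calls p) s.wt hinj
        (mem_edgePEs.2 ⟨rfl, ⟨h.1, rfl⟩, h.2⟩ : (⟨.edge, e, 0⟩ : PE) ∈ P)
    · refine writeAll_of_forall_ne _ _ fun p hp hpe => h ?_
      have hp' := mem_edgePEs.1 hp
      rw [show p.i = e from hpe] at hp'
      exact ⟨hp'.2.1.1, hp'.2.2⟩

/-- After phase 2 the entry `top[v]` of a vertex in the loop is an active hyperedge of `v` that no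
active hyperedge of `v` outweighs; `0` is possible too, but only if no active hyperedge of `v`
outweighs "none". -/
theorem exec_phase2 (ξ : ℕ → PE → ℝ) {s : State} {L : ℕ} (hI : HasInput I s)
    (hL : ∀ v, (I.vrow v).length ≤ 2 ^ L)
    (hvtmp : ∀ v, I.vrow v = [] → s.mem .vtmp v 0 = 0) :
    ∃ r, exec ξ (phase2 L) (loopPEs I av ae) s = some r ∧
      r.time ≤ 29 * L + 50 ∧ r.work ≤ 120 * (loopPEs I av ae).card ∧
      (∀ A, A ≠ .vtmp → A ≠ .top → r.st.mem A = s.mem A) ∧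
      r.st.wt = s.wt ∧ r.st.calls = s.calls ∧
      (∀ v, I.vrow v = [] → r.st.mem .vtmp v 0 = 0) ∧
      (∀ v, 1 ≤ v ∧ v ≤ n → av v →
        (r.st.mem .top v 0 ≠ 0 →
          r.st.mem .top v 0 ∈ I.vrow v ∧ s.mem .eInactive (r.st.mem .top v 0) 0 = 0) ∧
        (∀ e ∈ I.vrow v, s.mem .eInactive e 0 = 0 → s.wt e ≤ s.wt (r.st.mem .top v 0))) := by
  classical
  -- the list entries with the inactive hyperedges replaced by `0`
  let entry : ℕ → ℕ → ℕ := fun v j =>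
    (if s.mem .eInactive ((I.vrow v).getD j 0) 0 = 0 then 1 else 0) * (I.vrow v).getD j 0
  set x : Exp := .mul (.eq (get1 .eInactive (.get .vlist .i .j)) (.lit 0)) (.get .vlist .i .j)
    with hx
  have hxe : ∀ p : PE, x.eval s p = entry p.i p.j := by
    intro p
    change (if s.mem .eInactive (s.mem .vlist p.i p.j) 0 = 0 then 1 else 0) *
      s.mem .vlist p.i p.j = _
    rw [hI.vlist]
  have hxc : x.cost = 11 := rfl
  obtain ⟨r₁, hr₁, ht₁, hw₁, hm₁, hwt₁, hc₁, hu₁, hR₁⟩ := exec_slots ξ (S := .vtmp) (x := x)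
    (len := get1 .deg .i) (op := .heavier) (K := .vslot) (X := av)
    (ℓ := fun v => (I.vrow v).length)
    (f := fun a b => if s.wt a < s.wt b then b else a)
    (R := fun v a b u => (∃ j, a ≤ j ∧ j < b ∧ u = entry v j) ∧
      ∀ j, a ≤ j → j < b → s.wt (entry v j) ≤ s.wt u)
    (P := (loopPEs I av ae).filter fun p => p.kind = .vslot) (s := s) (L := L)
    (fun p => mem_vslotPEs)
    (fun s' hs' p => by
      change s'.mem .deg p.i 0 = _
      rw [hs' .deg (by decide), hI.deg])
    le_rfl
    (fun s' p a b hw => by simp only [Exp.eval, hw])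
    (fun a b => le_rfl)
    (fun v j _ _ => by
      rw [hxe]
      refine ⟨⟨j, le_rfl, by omega, rfl⟩, fun j' h1 h2 => ?_⟩
      rw [show j' = j by omega])
    (fun v a b c u w ⟨⟨j₁, h1, h2, h3⟩, h4⟩ ⟨⟨j₂, h5, h6, h7⟩, h8⟩ => by
      split_ifs with hlt
      · refine ⟨⟨j₂, by omega, h6, h7⟩, fun j hj1 hj2 => ?_⟩
        by_cases hjb : j < b
        · exact (h4 j hj1 hjb).trans hlt.le
        · exact h8 j (by omega) hj2
      · refine ⟨⟨j₁, h1, by omega, h3⟩, fun j hj1 hj2 => ?_⟩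
        by_cases hjb : j < b
        · exact h4 j hj1 hjb
        · exact (h8 j (by omega) hj2).trans (not_lt.1 hlt))
    hL
  set P := (loopPEs I av ae).filter fun p => p.kind = .vertex with hP
  set g : Exp := .eq (.eq (get1 .top .i) (get1 .vtmp .i)) (.lit 0) with hg
  have hge : ∀ p : PE, g.eval r₁.st p ≠ 0 ↔ r₁.st.mem .top p.i 0 ≠ r₁.st.mem .vtmp p.i 0 := by
    intro p
    change (if (if r₁.st.mem .top p.i 0 = r₁.st.mem .vtmp p.i 0 then 1 else 0) = 0 then 1 else 0)
      ≠ 0 ↔ _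
    split_ifs <;> simp_all
  have hwr := exec_write1_own ξ .top (get1 .vtmp .i) .vertex
    (P.filter fun p => g.eval r₁.st p ≠ 0) r₁.st (fun p hp => by
      have := mem_vertexPEs.1 (Finset.mem_filter.1 hp).1
      exact ⟨this.1, this.2.1.2⟩)
  have hex := exec_seq (exec_only (k := .vslot) hr₁) (exec_only (k := .vertex) <|
      exec_cond hwr)
  refine ⟨_, hex, ?_, ?_, ?_, hwt₁, hc₁, ?_, ?_⟩
  · change r₁.time + (10 + 6) ≤ _
    omega
  · change r₁.work + (10 * P.card + 6 * (P.filter fun p => g.eval r₁.st p ≠ 0).card) ≤ _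
    have e1 : ((loopPEs I av ae).filter fun p => p.kind = .vslot).card ≤ (loopPEs I av ae).card :=
      Finset.card_filter_le _ _
    have e2 : P.card ≤ (loopPEs I av ae).card := Finset.card_filter_le _ _
    have e3 : (P.filter fun p => g.eval r₁.st p ≠ 0).card ≤ P.card := Finset.card_filter_le _ _
    rw [hxc] at hw₁
    omega
  · intro A h1 h2
    rw [State.setArr_mem_of_ne _ _ h2, hm₁ A h1]
  · intro v hv
    rw [State.setArr_mem_of_ne _ _ (by decide), hu₁ v 0, hvtmp v hv]
    intro h
    have := (mem_vslotPEs.1 h).2.2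
    simp [hv] at this
  · intro v hv hav
    -- the write is skipped only if the cell has the right value already
    have htop : (r₁.st.setArr .top fun u w =>
        if (⟨.vertex, u, w⟩ : PE) ∈ P.filter fun p => g.eval r₁.st p ≠ 0 then
          (get1 .vtmp .i).eval r₁.st ⟨.vertex, u, w⟩ else r₁.st.mem .top u w).mem .top v 0 =
        r₁.st.mem .vtmp v 0 := by
      rw [State.setArr_mem_self]
      split_ifs with h
      · rfl
      · by_contra hne
        exact h (Finset.mem_filter.2 ⟨mem_vertexPEs.2 ⟨rfl, ⟨hv, rfl⟩, hav⟩, (hge _).2 hne⟩)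
    dsimp only
    rw [htop]
    -- the scratch cell of an isolated vertex is never written, so its top hyperedge is `0`
    rcases Nat.eq_zero_or_pos (I.vrow v).length with h0 | h0
    · have hnil := List.length_eq_zero_iff.1 h0
      have : r₁.st.mem .vtmp v 0 = 0 := by
        rw [hu₁ v 0, hvtmp v hnil]
        intro h
        have := (mem_vslotPEs.1 h).2.2
        simp [hnil] at this
      rw [this, hnil]
      simp
    · obtain ⟨⟨j, -, hj, hj'⟩, hmax⟩ := hR₁ v hav h0
      refine ⟨fun hne => ?_, fun e he hact => ?_⟩
      · rw [hj'] at hne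
        have h1 : s.mem .eInactive ((I.vrow v).getD j 0) 0 = 0 := by
          by_contra h
          exact hne (by simp only [entry, if_neg h, zero_mul])
        have h2 : entry v j = (I.vrow v).getD j 0 := by simp only [entry, if_pos h1, one_mul]
        rw [hj', h2]
        refine ⟨?_, h1⟩
        rw [List.getD_eq_getElem _ _ hj]
        exact List.getElem_mem _
      · obtain ⟨j', hj', rfl⟩ := List.getElem_of_mem he
        have := hmax j' (Nat.zero_le _) hj'
        have h2 : entry v j' = (I.vrow v)[j'] := by
          simp only [entry, List.getD_eq_getElem _ _ hj', if_pos hact, one_mul]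
        rwa [h2] at this

open Classical in
/-- In phase 3 precisely the hyperedges that are the top hyperedge of all their vertices are newly
completed. -/
theorem exec_phase3 (ξ : ℕ → PE → ℝ) {s : State} {L : ℕ} (hI : HasInput I s)
    (hL : ∀ e, (I.erow e).length ≤ 2 ^ L) :
    ∃ r, exec ξ (phase3 L) (loopPEs I av ae) s = some r ∧
      r.time ≤ 29 * L + 50 ∧ r.work ≤ 120 * (loopPEs I av ae).card ∧
      (∀ A, A ≠ .etmp → A ≠ .matched → A ≠ .eNew → r.st.mem A = s.mem A) ∧
      r.st.wt = s.wt ∧ r.st.calls = s.calls ∧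
      (∀ e, r.st.mem .eNew e 0 =
        if (1 ≤ e ∧ e ≤ m) ∧ ae e ∧ ∀ v ∈ I.erow e, s.mem .top v 0 = e then 1
        else s.mem .eNew e 0) := by
  set x : Exp := .eq (get1 .top (.get .elist .i .j)) .i with hx
  let vote : ℕ → ℕ → ℕ := fun e j => if s.mem .top ((I.erow e).getD j 0) 0 = e then 1 else 0
  have hxe : ∀ p : PE, x.eval s p = vote p.i p.j := by
    intro p
    change (if s.mem .top (s.mem .elist p.i p.j) 0 = p.i then 1 else 0) = _
    rw [hI.elist]
  have hxc : x.cost = 7 := rfl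
  obtain ⟨r₁, hr₁, ht₁, hw₁, hm₁, hwt₁, hc₁, -, hR₁⟩ := exec_slots ξ (S := .etmp) (x := x)
    (len := get1 .size .i) (op := .add) (K := .eslot) (X := ae)
    (ℓ := fun e => (I.erow e).length)
    (f := fun a b => a + b)
    (R := fun e a b u => a ≤ b ∧ u = ∑ j ∈ Finset.Ico a b, vote e j)
    (P := (loopPEs I av ae).filter fun p => p.kind = .eslot) (s := s) (L := L)
    (fun p => mem_eslotPEs)
    (fun s' hs' p => by
      change s'.mem .size p.i 0 = _
      rw [hs' .size (by decide), hI.size])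
    le_rfl
    (fun s' p a b hw => rfl)
    (fun a b => by simp [Exp.cost])
    (fun e j _ _ => by simp [hxe])
    (fun e a b c u w ⟨h1, h2⟩ ⟨h3, h4⟩ => ⟨h1.trans h3, by
      rw [h2, h4, Finset.sum_Ico_consecutive _ h1 h3]⟩)
    hL
  set P := (loopPEs I av ae).filter fun p => p.kind = .edge with hP
  set g : Exp := .eq (get1 .etmp .i) (get1 .size .i) with hg
  have hge : ∀ p : PE, (1 ≤ p.i ∧ p.i ≤ m) → ae p.i →
      (g.eval r₁.st p ≠ 0 ↔ ∀ v ∈ I.erow p.i, s.mem .top v 0 = p.i) := by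
    intro p hp hae
    change (if r₁.st.mem .etmp p.i 0 = r₁.st.mem .size p.i 0 then 1 else 0) ≠ 0 ↔ _
    rw [ite_ne_right_iff, and_iff_left one_ne_zero, hm₁ .size (by decide), hI.size,
      (hR₁ p.i hae (I.length_erow_pos hp)).2]
    -- a sum of zeros and ones equals the number of summands iff all of them are one
    have hle : ∀ j ∈ Finset.Ico 0 (I.erow p.i).length, vote p.i j ≤ 1 := by
      intro j _; simp only [vote]; split_ifs <;> omega
    have hcard : ∑ _j ∈ Finset.Ico 0 (I.erow p.i).length, 1 = (I.erow p.i).length := by simp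
    rw [show (∑ j ∈ Finset.Ico 0 (I.erow p.i).length, vote p.i j = (I.erow p.i).length) ↔
      ∀ j ∈ Finset.Ico 0 (I.erow p.i).length, vote p.i j = 1 by
        conv_lhs => rhs; rw [← hcard]
        exact Finset.sum_eq_sum_iff_of_le hle]
    constructor
    · intro h v hv
      obtain ⟨j, hj, rfl⟩ := List.getElem_of_mem hv
      have := h j (by simpa using hj)
      simp only [vote, List.getD_eq_getElem _ _ hj] at this
      by_contra hne
      simp [hne] at this
    · intro h j hj
      have hj' : j < (I.erow p.i).length := by simpa using hj
      simp only [vote, List.getD_eq_getElem _ _ hj']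
      rw [if_pos (h _ (List.getElem_mem hj'))]
  set Q := P.filter fun p => g.eval r₁.st p ≠ 0 with hQ
  have hQ' : ∀ p ∈ Q, p.kind = .edge ∧ p.j = 0 := fun p hp => by
    have := mem_edgePEs.1 (Finset.mem_filter.1 hp).1
    exact ⟨this.1, this.2.1.2⟩
  have hex := exec_seq (exec_only (k := .eslot) hr₁) (exec_only (k := .edge) <|
      exec_cond (g := g) (exec_seq (exec_write1_own ξ .matched (.lit 1) .edge Q r₁.st hQ')
        (exec_write1_own ξ .eNew (.lit 1) .edge Q _ hQ')))
  refine ⟨_, hex, ?_, ?_, ?_, hwt₁, hc₁, ?_⟩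
  · change r₁.time + (8 + (4 + 4)) ≤ _
    omega
  · change r₁.work + (8 * P.card + (4 * Q.card + 4 * Q.card)) ≤ _
    have e1 : ((loopPEs I av ae).filter fun p => p.kind = .eslot).card ≤ (loopPEs I av ae).card :=
      Finset.card_filter_le _ _
    have e2 : P.card ≤ (loopPEs I av ae).card := Finset.card_filter_le _ _
    have e3 : Q.card ≤ P.card := Finset.card_filter_le _ _
    rw [hxc] at hw₁
    omega
  · intro A h1 h2 h3
    rw [State.setArr_mem_of_ne _ _ h3, State.setArr_mem_of_ne _ _ h2, hm₁ A h1]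
  · intro e
    dsimp only
    rw [State.setArr_mem_self, State.setArr_mem_of_ne _ _ (by decide), hm₁ .eNew (by decide)]
    have : (⟨.edge, e, 0⟩ : PE) ∈ Q ↔
        (1 ≤ e ∧ e ≤ m) ∧ ae e ∧ ∀ v ∈ I.erow e, s.mem .top v 0 = e := by
      rw [hQ, Finset.mem_filter, hP, mem_edgePEs]
      constructor
      · rintro ⟨⟨-, ⟨h1, -⟩, h2⟩, h3⟩
        exact ⟨h1, h2, (hge ⟨.edge, e, 0⟩ h1 h2).1 h3⟩
      · rintro ⟨h1, h2, h3⟩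
        exact ⟨⟨rfl, ⟨h1, rfl⟩, h2⟩, (hge ⟨.edge, e, 0⟩ h1 h2).2 h3⟩
    simp only [this]
    rfl

open Classical in
/-- Phase 4 has no write conflict as long as no vertex in the loop is in two newly completed
hyperedges. -/
theorem exec_phase4 (ξ : ℕ → PE → ℝ) {s : State} (hI : HasInput I s)
    (huniq : ∀ v, av v → ∀ e ∈ I.vrow v, ∀ e' ∈ I.vrow v,
      s.mem .eNew e 0 ≠ 0 → s.mem .eNew e' 0 ≠ 0 → e = e') :
    ∃ r, exec ξ phase4 (loopPEs I av ae) s = some r ∧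
      r.time ≤ 50 ∧ r.work ≤ 50 * (loopPEs I av ae).card ∧
      (∀ A, A ≠ .vNew → r.st.mem A = s.mem A) ∧
      r.st.wt = s.wt ∧ r.st.calls = s.calls ∧
      (∀ v, r.st.mem .vNew v 0 =
        if av v ∧ ∃ e ∈ I.vrow v, s.mem .eNew e 0 ≠ 0 then 1 else s.mem .vNew v 0) := by
  set P := (loopPEs I av ae).filter fun p => p.kind = .vslot with hP
  set g : Exp := get1 .eNew (.get .vlist .i .j) with hg
  have hge : ∀ p : PE, g.eval s p = s.mem .eNew ((I.vrow p.i).getD p.j 0) 0 := by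
    intro p
    change s.mem .eNew (s.mem .vlist p.i p.j) 0 = _
    rw [hI.vlist]
  set Q := P.filter fun p => g.eval s p ≠ 0 with hQ
  have hQ' : ∀ p, p ∈ Q ↔ p.kind = .vslot ∧ av p.i ∧ ∃ h : p.j < (I.vrow p.i).length,
      s.mem .eNew ((I.vrow p.i)[p.j]) 0 ≠ 0 := by
    intro p
    rw [hQ, Finset.mem_filter, hP, mem_vslotPEs, hge]
    constructor
    · rintro ⟨⟨h1, h2, h3⟩, h4⟩
      rw [List.getD_eq_getElem _ _ h3] at h4
      exact ⟨h1, h2, h3, h4⟩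
    · rintro ⟨h1, h2, h3, h4⟩
      rw [List.getD_eq_getElem _ _ h3]
      exact ⟨⟨h1, h2, h3⟩, h4⟩
  have hinj : Set.InjOn (fun p => (Exp.i.eval s p, (Exp.lit 0).eval s p)) (Q : Set PE) := by
    rintro ⟨K, i, j⟩ hp ⟨K', i', j'⟩ hq h
    obtain ⟨h1, h2, h3, h4⟩ := (hQ' _).1 (Finset.mem_coe.1 hp)
    obtain ⟨h1', h2', h3', h4'⟩ := (hQ' _).1 (Finset.mem_coe.1 hq)
    simp only [Exp.eval, Prod.mk.injEq, and_true] at h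
    dsimp only at h1 h2 h3 h4 h1' h2' h3' h4'
    subst h1 h1' h
    have := huniq i h2 _ (List.getElem_mem h3) _ (List.getElem_mem h3') h4 h4'
    rw [(I.vrow_nodup i).getElem_inj_iff] at this
    rw [this]
  have hwr : exec ξ (write1 .vNew .i (.lit 1)) Q s = some
      ⟨s.setArr .vNew fun u v => writeAll Q (fun p => (Exp.i.eval s p, (Exp.lit 0).eval s p))
        (fun p => (Exp.lit 1).eval s p) (fun c => s.mem .vNew c.1 c.2) (u, v), 4, 4 * Q.card⟩ := by
    simp only [write1, exec]
    rw [if_pos hinj]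
    rfl
  have hex := exec_only (k := .vslot) (exec_cond hwr)
  refine ⟨_, hex, ?_, ?_, ?_, rfl, rfl, ?_⟩
  · change 6 + 4 ≤ 50
    omega
  · change 6 * P.card + 4 * Q.card ≤ _
    have e2 : P.card ≤ (loopPEs I av ae).card := Finset.card_filter_le _ _
    have e3 : Q.card ≤ P.card := Finset.card_filter_le _ _
    omega
  · intro A h
    exact State.setArr_mem_of_ne _ _ h
  · intro v
    dsimp only
    rw [State.setArr_mem_self]
    split_ifs with h
    · obtain ⟨hav, e, he, hne⟩ := h
      obtain ⟨j, hj, rfl⟩ := List.getElem_of_mem he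
      exact writeAll_of_mem (fun p => (Exp.lit 1).eval s p) (fun c : ℕ × ℕ => s.mem .vNew c.1 c.2)
        hinj (show (⟨.vslot, v, j⟩ : PE) ∈ Q from (hQ' _).2 ⟨rfl, hav, hj, hne⟩)
    · refine writeAll_of_forall_ne _ _ fun p hp hpe => h ?_
      obtain ⟨-, h2, h3, h4⟩ := (hQ' _).1 hp
      have hpi : p.i = v := (Prod.mk.inj hpe).1
      subst hpi
      exact ⟨h2, _, List.getElem_mem h3, h4⟩

/-- In phase 5 the hyperedges with a newly completed vertex become inactive. -/
theorem exec_phase5 (ξ : ℕ → PE → ℝ) {s : State} {L : ℕ} (hI : HasInput I s)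
    (hL : ∀ e, (I.erow e).length ≤ 2 ^ L) :
    ∃ r, exec ξ (phase5 L) (loopPEs I av ae) s = some r ∧
      r.time ≤ 29 * L + 50 ∧ r.work ≤ 120 * (loopPEs I av ae).card ∧
      (∀ A, A ≠ .etmp → A ≠ .eInactive → r.st.mem A = s.mem A) ∧
      r.st.wt = s.wt ∧ r.st.calls = s.calls ∧
      (∀ e, r.st.mem .eInactive e 0 ≠ 0 ↔ s.mem .eInactive e 0 ≠ 0 ∨
        ((1 ≤ e ∧ e ≤ m) ∧ ae e ∧ ∃ v ∈ I.erow e, s.mem .vNew v 0 ≠ 0)) := by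
  classical
  set x : Exp := get1 .vNew (.get .elist .i .j) with hx
  have hxe : ∀ p : PE, x.eval s p = s.mem .vNew ((I.erow p.i).getD p.j 0) 0 := by
    intro p
    change s.mem .vNew (s.mem .elist p.i p.j) 0 = _
    rw [hI.elist]
  have hxc : x.cost = 5 := rfl
  obtain ⟨r₁, hr₁, ht₁, hw₁, hm₁, hwt₁, hc₁, -, hR₁⟩ := exec_slots ξ (S := .etmp) (x := x)
    (len := get1 .size .i) (op := .or) (K := .eslot) (X := ae)
    (ℓ := fun e => (I.erow e).length)
    (f := fun a b => if a = 0 ∧ b = 0 then 0 else 1)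
    (R := fun e a b u => a ≤ b ∧
      (u = 0 ↔ ∀ j, a ≤ j → j < b → s.mem .vNew ((I.erow e).getD j 0) 0 = 0))
    (P := (loopPEs I av ae).filter fun p => p.kind = .eslot) (s := s) (L := L)
    (fun p => mem_eslotPEs)
    (fun s' hs' p => by
      change s'.mem .size p.i 0 = _
      rw [hs' .size (by decide), hI.size])
    le_rfl
    (fun s' p a b hw => rfl)
    (fun a b => by simp [Exp.cost])
    (fun e j _ _ => by
      rw [hxe]
      refine ⟨Nat.le_succ _, fun h j' h1 h2 => ?_, fun h => h j le_rfl (Nat.lt_succ_self _)⟩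
      rwa [show j' = j by omega])
    (fun e a b c u w ⟨h1, h2⟩ ⟨h3, h4⟩ => ⟨h1.trans h3, by
      have : ((if u = 0 ∧ w = 0 then 0 else 1) = 0) ↔ u = 0 ∧ w = 0 := by split_ifs <;> simp_all
      rw [this, h2, h4]
      constructor
      · rintro ⟨h5, h6⟩ j hj1 hj2
        by_cases hjb : j < b
        · exact h5 j hj1 hjb
        · exact h6 j (by omega) hj2
      · exact fun h => ⟨fun j hj1 hj2 => h j hj1 (by omega), fun j hj1 hj2 => h j (by omega) hj2⟩⟩)
    hL
  set P := (loopPEs I av ae).filter fun p => p.kind = .edge with hP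
  set Q := P.filter fun p => (get1 .etmp .i).eval r₁.st p ≠ 0 with hQ
  have hQ' : ∀ p ∈ Q, p.kind = .edge ∧ p.j = 0 := fun p hp => by
    have := mem_edgePEs.1 (Finset.mem_filter.1 hp).1
    exact ⟨this.1, this.2.1.2⟩
  have hex := exec_seq (exec_only (k := .eslot) hr₁) (exec_only (k := .edge) <|
      exec_cond (g := get1 .etmp .i) (exec_write1_own ξ .eInactive (.lit 1) .edge Q r₁.st hQ'))
  refine ⟨_, hex, ?_, ?_, ?_, hwt₁, hc₁, ?_⟩
  · change r₁.time + (4 + 4) ≤ _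
    omega
  · change r₁.work + (4 * P.card + 4 * Q.card) ≤ _
    have e1 : ((loopPEs I av ae).filter fun p => p.kind = .eslot).card ≤ (loopPEs I av ae).card :=
      Finset.card_filter_le _ _
    have e2 : P.card ≤ (loopPEs I av ae).card := Finset.card_filter_le _ _
    have e3 : Q.card ≤ P.card := Finset.card_filter_le _ _
    rw [hxc] at hw₁
    omega
  · intro A h1 h2
    rw [State.setArr_mem_of_ne _ _ h2, hm₁ A h1]
  · intro e
    dsimp only
    rw [State.setArr_mem_self, hm₁ .eInactive (by decide)]
    have : (⟨.edge, e, 0⟩ : PE) ∈ Q ↔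
        (1 ≤ e ∧ e ≤ m) ∧ ae e ∧ ∃ v ∈ I.erow e, s.mem .vNew v 0 ≠ 0 := by
      rw [hQ, Finset.mem_filter, hP, mem_edgePEs]
      change (_ ∧ (_ ∧ _) ∧ _) ∧ r₁.st.mem .etmp e 0 ≠ 0 ↔ _
      have key : (1 ≤ e ∧ e ≤ m) → ae e →
          (r₁.st.mem .etmp e 0 ≠ 0 ↔ ∃ v ∈ I.erow e, s.mem .vNew v 0 ≠ 0) := by
        intro h1 h2
        rw [Ne, (hR₁ e h2 (I.length_erow_pos h1)).2]
        push Not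
        constructor
        · rintro ⟨j, -, hj, h⟩
          rw [List.getD_eq_getElem _ _ hj] at h
          exact ⟨_, List.getElem_mem hj, h⟩
        · rintro ⟨v, hv, h⟩
          obtain ⟨j, hj, rfl⟩ := List.getElem_of_mem hv
          exact ⟨j, Nat.zero_le _, hj, by rwa [List.getD_eq_getElem _ _ hj]⟩
      constructor
      · rintro ⟨⟨-, ⟨h1, -⟩, h2⟩, h3⟩
        exact ⟨h1, h2, (key h1 h2).1 h3⟩
      · rintro ⟨h1, h2, h3⟩
        exact ⟨⟨rfl, ⟨h1, rfl⟩, h2⟩, (key h1 h2).2 h3⟩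
    simp only [this]
    split_ifs with h
    · exact ⟨fun _ => Or.inr h, fun _ => one_ne_zero⟩
    · simp [h]

theorem exec_phase6 (ξ : ℕ → PE → ℝ) (I : Lists H) (av ae : ℕ → Prop) (s : State) :
    ∃ r, exec ξ phase6 (loopPEs I av ae) s = some r ∧
      r.time ≤ 50 ∧ r.work ≤ 50 * (loopPEs I av ae).card ∧
      (∀ A, A ≠ .vInactive → r.st.mem A = s.mem A) ∧
      r.st.wt = s.wt ∧ r.st.calls = s.calls ∧
      (∀ v, r.st.mem .vInactive v 0 ≠ 0 ↔ s.mem .vInactive v 0 ≠ 0 ∨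
        ((1 ≤ v ∧ v ≤ n) ∧ av v ∧ s.mem .vNew v 0 ≠ 0)) := by
  set P := (loopPEs I av ae).filter fun p => p.kind = .vertex with hP
  set Q := P.filter fun p => (get1 .vNew .i).eval s p ≠ 0 with hQ
  have hQ' : ∀ p ∈ Q, p.kind = .vertex ∧ p.j = 0 := fun p hp => by
    have := mem_vertexPEs.1 (Finset.mem_filter.1 hp).1
    exact ⟨this.1, this.2.1.2⟩
  have hex := exec_only (k := .vertex) <|
    exec_cond (g := get1 .vNew .i) (exec_write1_own ξ .vInactive (.lit 1) .vertex Q s hQ')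
  refine ⟨_, hex, ?_, ?_, ?_, rfl, rfl, ?_⟩
  · change 4 + 4 ≤ 50
    omega
  · change 4 * P.card + 4 * Q.card ≤ _
    have e2 : P.card ≤ (loopPEs I av ae).card := Finset.card_filter_le _ _
    have e3 : Q.card ≤ P.card := Finset.card_filter_le _ _
    omega
  · intro A h
    exact State.setArr_mem_of_ne _ _ h
  · intro v
    have : (⟨.vertex, v, 0⟩ : PE) ∈ Q ↔ (1 ≤ v ∧ v ≤ n) ∧ av v ∧ s.mem .vNew v 0 ≠ 0 := by
      rw [hQ, Finset.mem_filter, hP, mem_vertexPEs]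
      change (_ ∧ (_ ∧ _) ∧ _) ∧ s.mem .vNew v 0 ≠ 0 ↔ _
      constructor
      · rintro ⟨⟨-, ⟨h1, -⟩, h2⟩, h3⟩
        exact ⟨h1, h2, h3⟩
      · rintro ⟨h1, h2, h3⟩
        exact ⟨⟨rfl, ⟨h1, rfl⟩, h2⟩, h3⟩
    simp only [State.setArr_mem_self]
    rw [← this]
    split_ifs with h
    · exact ⟨fun _ => Or.inr h, fun _ => one_ne_zero⟩
    · simp [h]

/-! ### Rounds -/

/-- The invariant of the loop that guarantees the absence of write conflicts, where `av` and `ae`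
are the vertices and hyperedges whose PEs are in the loop: these hyperedges are the active ones, and
the vertices of hyperedges completed in former rounds have left.  The scratch cells of isolated
vertices stay cleared, because the result of the MAX-reduction is read from there.  No assumption is made on the
random numbers, so a vertex may have left although some of its hyperedges are active. -/
structure LoopInv (I : Lists H) (av ae : ℕ → Prop) (s : State) : Prop where
  input : HasInput I s
  active_iff : ∀ e, 1 ≤ e ∧ e ≤ m → (ae e ↔ s.mem .eInactive e 0 = 0)
  left_of_completed : ∀ e v, v ∈ I.erow e → s.mem .eNew e 0 ≠ 0 → ¬ av v
  vtmp_of_nil : ∀ v, I.vrow v = [] → s.mem .vtmp v 0 = 0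

open Classical in
/-- The effect of a round that starts in state `s` and ends in state `s'`. -/
structure RoundSpec (I : Lists H) (av ae : ℕ → Prop) (ξ : ℕ → PE → ℝ) (s s' : State) : Prop where
  calls : s'.calls = s.calls + 1
  wt : ∀ e, s'.wt e = if (1 ≤ e ∧ e ≤ m) ∧ ae e then ξ s.calls ⟨.edge, e, 0⟩ else s.wt e
  top_mem : ∀ v, 1 ≤ v ∧ v ≤ n → av v → s'.mem .top v 0 ≠ 0 →
    s'.mem .top v 0 ∈ I.vrow v ∧ s.mem .eInactive (s'.mem .top v 0) 0 = 0
  top_max : ∀ v, 1 ≤ v ∧ v ≤ n → av v → ∀ e ∈ I.vrow v, s.mem .eInactive e 0 = 0 →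
    s'.wt e ≤ s'.wt (s'.mem .top v 0)
  eNew : ∀ e, s'.mem .eNew e 0 =
    if (1 ≤ e ∧ e ≤ m) ∧ ae e ∧ ∀ v ∈ I.erow e, s'.mem .top v 0 = e then 1 else s.mem .eNew e 0
  vNew : ∀ v, s'.mem .vNew v 0 =
    if av v ∧ ∃ e ∈ I.vrow v, s'.mem .eNew e 0 ≠ 0 then 1 else s.mem .vNew v 0
  eInactive : ∀ e, s'.mem .eInactive e 0 ≠ 0 ↔ s.mem .eInactive e 0 ≠ 0 ∨
    ((1 ≤ e ∧ e ≤ m) ∧ ae e ∧ ∃ v ∈ I.erow e, s'.mem .vNew v 0 ≠ 0)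
  vInactive : ∀ v, s'.mem .vInactive v 0 ≠ 0 ↔ s.mem .vInactive v 0 ≠ 0 ∨
    ((1 ≤ v ∧ v ≤ n) ∧ av v ∧ s'.mem .vNew v 0 ≠ 0)

theorem exec_round (ξ : ℕ → PE → ℝ) {s : State} {LΔ Ld : ℕ} (hs : LoopInv I av ae s)
    (hΔ : ∀ v, (I.vrow v).length ≤ 2 ^ LΔ) (hd : ∀ e, (I.erow e).length ≤ 2 ^ Ld) :
    ∃ r, exec ξ (roundCode LΔ Ld) (loopPEs I av ae) s = some r ∧
      r.time ≤ 29 * LΔ + 58 * Ld + 253 ∧ r.work ≤ 463 * (loopPEs I av ae).card ∧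
      HasInput I r.st ∧ (∀ v, I.vrow v = [] → r.st.mem .vtmp v 0 = 0) ∧
      RoundSpec I av ae ξ s r.st := by
  obtain ⟨r₁, h₁, t₁, w₁, m₁, c₁, q₁⟩ := exec_phase1 ξ I av ae s
  have i₁ : HasInput I r₁.st := hs.input.mono fun A _ => by rw [m₁]
  obtain ⟨r₂, h₂, t₂, w₂, m₂, u₂, c₂, n₂, q₂⟩ := exec_phase2 (av := av) (ae := ae) ξ i₁ hΔ
    (by rw [m₁]; exact hs.vtmp_of_nil)
  have i₂ : HasInput I r₂.st := i₁.mono fun A hA => by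
    rcases hA with rfl | rfl | rfl | rfl <;> exact m₂ _ (by decide) (by decide)
  obtain ⟨r₃, h₃, t₃, w₃, m₃, u₃, c₃, q₃⟩ := exec_phase3 (av := av) (ae := ae) ξ i₂ hd
  have i₃ : HasInput I r₃.st := i₂.mono fun A hA => by
    rcases hA with rfl | rfl | rfl | rfl <;> exact m₃ _ (by decide) (by decide) (by decide)
  have new₂ : ∀ e, r₂.st.mem .eNew e 0 = s.mem .eNew e 0 := fun e => by
    rw [m₂ _ (by decide) (by decide), m₁]
  obtain ⟨r₄, h₄, t₄, w₄, m₄, u₄, c₄, q₄⟩ := exec_phase4 (av := av) (ae := ae) ξ i₃ (by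
    -- a newly completed hyperedge of a vertex in the loop is the top hyperedge of this vertex
    have key : ∀ v, av v → ∀ e ∈ I.vrow v, r₃.st.mem .eNew e 0 ≠ 0 → r₂.st.mem .top v 0 = e := by
      intro v hv e he hne
      rw [q₃ e] at hne
      split_ifs at hne with h
      · exact h.2.2 v (I.mem_erow_iff.2 he)
      · exact absurd hv (hs.left_of_completed e v (I.mem_erow_iff.2 he) (by rwa [← new₂]))
    intro v hv e he e' he' hne hne'
    rw [← key v hv e he hne, ← key v hv e' he' hne'])
  have i₄ : HasInput I r₄.st := i₃.mono fun A hA => by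
    rcases hA with rfl | rfl | rfl | rfl <;> exact m₄ _ (by decide)
  obtain ⟨r₅, h₅, t₅, w₅, m₅, u₅, c₅, q₅⟩ := exec_phase5 (av := av) (ae := ae) ξ i₄ hd
  have i₅ : HasInput I r₅.st := i₄.mono fun A hA => by
    rcases hA with rfl | rfl | rfl | rfl <;> exact m₅ _ (by decide) (by decide)
  obtain ⟨r₆, h₆, t₆, w₆, m₆, u₆, c₆, q₆⟩ := exec_phase6 ξ I av ae r₅.st
  have i₆ : HasInput I r₆.st := i₅.mono fun A hA => by
    rcases hA with rfl | rfl | rfl | rfl <;> exact m₆ _ (by decide)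
  have wt₆ : r₆.st.wt = r₁.st.wt := by rw [u₆, u₅, u₄, u₃, u₂]
  have top₆ : r₆.st.mem .top = r₂.st.mem .top := by
    rw [m₆ _ (by decide), m₅ _ (by decide) (by decide), m₄ _ (by decide),
      m₃ _ (by decide) (by decide) (by decide)]
  have eNew₆ : r₆.st.mem .eNew = r₃.st.mem .eNew := by
    rw [m₆ _ (by decide), m₅ _ (by decide) (by decide), m₄ _ (by decide)]
  have vNew₅ : r₅.st.mem .vNew = r₄.st.mem .vNew := m₅ _ (by decide) (by decide)
  have vNew₆ : r₆.st.mem .vNew = r₄.st.mem .vNew := by rw [m₆ _ (by decide), vNew₅]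
  refine ⟨_, exec_seq h₁ (exec_seq h₂ (exec_seq h₃ (exec_seq h₄ (exec_seq h₅ h₆)))),
    ?_, ?_, i₆, ?_, ?_⟩
  · dsimp only; omega
  · dsimp only; omega
  · intro v hv
    rw [m₆ _ (by decide), m₅ _ (by decide) (by decide), m₄ _ (by decide),
      m₃ _ (by decide) (by decide) (by decide)]
    exact n₂ v hv
  · refine ⟨?_, ?_, ?_, ?_, ?_, ?_, ?_, ?_⟩
    · rw [c₆, c₅, c₄, c₃, c₂, c₁]
    · intro e; rw [wt₆]; exact q₁ e
    · intro v hv hav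
      rw [top₆, ← m₁]
      exact (q₂ v hv hav).1
    · intro v hv hav
      rw [top₆, wt₆, ← m₁]
      exact (q₂ v hv hav).2
    · intro e
      rw [top₆, eNew₆, q₃, new₂]
    · intro v
      rw [vNew₆, eNew₆, q₄, m₃ .vNew (by decide) (by decide) (by decide),
        m₂ .vNew (by decide) (by decide), m₁]
    · intro e
      rw [m₆ _ (by decide), q₅, vNew₆, m₄ _ (by decide),
        m₃ _ (by decide) (by decide) (by decide), m₂ _ (by decide) (by decide), m₁]
    · intro v
      rw [q₆, vNew₆, vNew₅, m₅ _ (by decide) (by decide), m₄ _ (by decide),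
        m₃ _ (by decide) (by decide) (by decide), m₂ _ (by decide) (by decide), m₁]

/-- The vertices whose PEs stay in the loop after a round ending in state `s`. -/
def vertexStays (av : ℕ → Prop) (s : State) (v : ℕ) : Prop :=
  av v ∧ s.mem .vInactive v 0 = 0 ∧ 0 < s.mem .top v 0

/-- The hyperedges whose PEs stay in the loop after a round ending in state `s`. -/
def edgeStays (ae : ℕ → Prop) (s : State) (e : ℕ) : Prop :=
  ae e ∧ s.mem .eInactive e 0 = 0

theorem filter_stays (s : State) :
    ((loopPEs I av ae).filter fun p => (stays p.kind).eval s p ≠ 0) =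
      loopPEs I (vertexStays av s) (edgeStays ae s) := by
  ext ⟨K, i, j⟩
  simp only [Finset.mem_filter, mem_loopPEs, and_assoc]
  refine and_congr_right fun _ => ?_
  have hv : ∀ x y : ℕ, (if x = 0 then 1 else 0) * (if 0 < y then 1 else 0) ≠ 0 ↔ x = 0 ∧ 0 < y := by
    intro x y; split_ifs <;> simp_all
  have he : ∀ x : ℕ, (if x = 0 then 1 else 0) ≠ 0 ↔ x = 0 := by
    intro x; split_ifs <;> simp_all
  cases K
  · exact and_congr_right fun _ => hv _ _
  · exact and_congr_right fun _ => he _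
  · exact and_congr_right fun _ => hv _ _
  · exact and_congr_right fun _ => he _

theorem LoopInv.next {ξ : ℕ → PE → ℝ} {s s' : State} (hs : LoopInv I av ae s)
    (hI : HasInput I s') (hnil : ∀ v, I.vrow v = [] → s'.mem .vtmp v 0 = 0)
    (h : RoundSpec I av ae ξ s s') :
    LoopInv I (vertexStays av s') (edgeStays ae s') s' where
  input := hI
  active_iff e he := by
    unfold edgeStays
    refine ⟨fun h' => h'.2, fun h0 => ⟨?_, h0⟩⟩
    by_contra hae
    have : s.mem .eInactive e 0 ≠ 0 := fun h' => hae ((hs.active_iff e he).2 h')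
    exact (h.eInactive e).2 (Or.inl this) h0
  left_of_completed e v hv hne := by
    rintro ⟨hav, h0, -⟩
    have hev := I.mem_erow_iff.1 hv
    have hvn : s'.mem .vNew v 0 ≠ 0 := by
      rw [h.vNew, if_pos ⟨hav, e, hev, hne⟩]
      exact one_ne_zero
    exact (h.vInactive v).2 (Or.inr ⟨(I.bounds_of_mem_vrow hev).1, hav, hvn⟩) h0
  vtmp_of_nil := hnil

/-- The loop body from any configuration that satisfies the invariant. -/
theorem loopBody_spec (ξ : ℕ → PE → ℝ) {c : Config} (halive : c.alive = loopPEs I av ae)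
    (hs : LoopInv I av ae c.st) :
    ∃ c', loopBody ξ (Nat.clog 2 H.maxDegree) (Nat.clog 2 H.rank) c = some c' ∧
      c'.alive = loopPEs I (vertexStays av c'.st) (edgeStays ae c'.st) ∧
      LoopInv I (vertexStays av c'.st) (edgeStays ae c'.st) c'.st ∧
      RoundSpec I av ae ξ c.st c'.st ∧
      c'.time ≤ c.time + (29 * Nat.clog 2 H.maxDegree + 58 * Nat.clog 2 H.rank + 271) ∧
      c'.work ≤ c.work + 1425 * (H.kappa + n) := by
  obtain ⟨r, hr, ht, hw, hI, hnil, hspec⟩ := exec_round ξ (LΔ := Nat.clog 2 H.maxDegree)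
    (Ld := Nat.clog 2 H.rank) hs
    (fun v => (I.length_vrow_le v).trans (Nat.le_pow_clog one_lt_two _))
    (fun e => (I.length_erow_le e).trans (Nat.le_pow_clog one_lt_two _))
  refine ⟨⟨r.st, c.alive.filter fun p => (stays p.kind).eval r.st p ≠ 0,
      c.time + r.time + testCost .vertex + testCost .edge,
      c.work + r.work + ∑ p ∈ c.alive, testCost p.kind⟩, ?_, ?_, hs.next hI hnil hspec, hspec,
      ?_, ?_⟩
  · rw [loopBody, halive, hr]
    rfl
  · dsimp only
    rw [halive, filter_stays]
  · dsimp only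
    have h1 : testCost .vertex = 12 := rfl
    have h2 : testCost .edge = 6 := rfl
    omega
  · dsimp only
    have h1 : ∑ p ∈ c.alive, testCost p.kind ≤ c.alive.card • 12 := by
      refine Finset.sum_le_card_nsmul _ _ _ fun p _ => ?_
      cases p.kind <;> decide
    have h2 : (loopPEs I av ae).card ≤ 3 * (H.kappa + n) :=
      (Finset.card_le_card fun p hp => (mem_allPEs I p).2 (mem_loopPEs.1 hp).1).trans
        (card_allPEs_le I)
    rw [smul_eq_mul, halive] at h1
    rw [halive]
    omega

theorem loopPEs_true (I : Lists H) : loopPEs I (fun _ => True) (fun _ => True) = allPEs I := by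
  classical
  ext ⟨K, i, j⟩
  rw [mem_loopPEs, mem_allPEs]
  cases K <;> simp [PE.Owned]

theorem run_zero (I : Lists H) (ξ : ℕ → PE → ℝ) :
    ∃ c, run I ξ 0 = some c ∧ c.alive = loopPEs I (fun _ => True) (fun _ => True) ∧
      c.st.wt = (fun _ => -1) ∧ c.st.calls = 0 ∧
      (∀ A, A ≠ .top → c.st.mem A = (initState I).mem A) ∧
      c.time ≤ 4 ∧ c.work ≤ 12 * (H.kappa + n) := by
  set P := (allPEs I).filter fun p => p.kind = .vertex with hP
  have hwr := exec_write1_own ξ .top (.lit 0) .vertex P (initState I) (fun p hp => by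
    rw [hP, ← loopPEs_true I] at hp
    have := mem_vertexPEs.1 hp
    exact ⟨this.1, this.2.1.2⟩)
  have hex := exec_only (k := .vertex) hwr
  refine ⟨_, by rw [run, initCode, hex]; rfl, (loopPEs_true I).symm, rfl, rfl, ?_, le_rfl, ?_⟩
  · intro A hA
    exact State.setArr_mem_of_ne _ _ hA
  · change 4 * P.card ≤ _
    have h1 : P.card ≤ (allPEs I).card := Finset.card_filter_le _ _
    have h2 := card_allPEs_le I
    omega

theorem loopInv_of_initState {s : State} (h : ∀ A, A ≠ .top → s.mem A = (initState I).mem A) :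
    LoopInv I (fun _ => True) (fun _ => True) s where
  input A hA := h A (by rintro rfl; simp [Arr.IsInput] at hA)
  active_iff e _ := by rw [h _ (by decide)]; exact ⟨fun _ => rfl, fun _ => trivial⟩
  left_of_completed e v _ hne := by rw [h _ (by decide)] at hne; exact absurd rfl hne
  vtmp_of_nil v _ := by rw [h _ (by decide)]; rfl

/-- The machine never gets stuck, whatever the random numbers are. -/
theorem exists_run (I : Lists H) (ξ : ℕ → PE → ℝ) (k : ℕ) :
    ∃ c, run I ξ k = some c ∧
      (∃ av ae, c.alive = loopPEs I av ae ∧ LoopInv I av ae c.st) ∧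
      c.time ≤ 4 + k * (29 * Nat.clog 2 H.maxDegree + 58 * Nat.clog 2 H.rank + 271) ∧
      c.work ≤ 12 * (H.kappa + n) + k * (1425 * (H.kappa + n)) := by
  induction k with
  | zero =>
    obtain ⟨c, hc, ha, -, -, hm, ht, hw⟩ := run_zero I ξ
    exact ⟨c, hc, ⟨_, _, ha, loopInv_of_initState hm⟩, by simpa using ht, by simpa using hw⟩
  | succ k ih =>
    obtain ⟨c, hc, ⟨av, ae, ha, hinv⟩, ht, hw⟩ := ih
    obtain ⟨c', hc', ha', hinv', -, ht', hw'⟩ := loopBody_spec ξ ha hinv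
    refine ⟨c', by rw [run, hc]; exact hc', ⟨_, _, ha', hinv'⟩, ?_, ?_⟩
    · rw [add_one_mul k]; linarith
    · rw [add_one_mul k]; omega

theorem clog_le_log {k : ℕ} (hk : 1 ≤ k) : (Nat.clog 2 k : ℝ) ≤ 1 + 2 * Real.log k := by
  rcases hk.eq_or_lt with rfl | hk
  · simp
  have h1 : 2 ^ (Nat.clog 2 k).pred < k := Nat.pow_pred_clog_lt_self one_lt_two hk
  have h2 : ((Nat.clog 2 k).pred : ℝ) * Real.log 2 ≤ Real.log k := by
    rw [← Real.log_pow]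
    exact Real.log_le_log (by positivity) (by exact_mod_cast h1.le)
  have h3 : (Nat.clog 2 k : ℝ) ≤ (Nat.clog 2 k).pred + 1 := by
    exact_mod_cast Nat.le_succ_of_pred_le le_rfl
  have h4 := Real.log_two_gt_d9
  have h5 : (0 : ℝ) ≤ (Nat.clog 2 k).pred := Nat.cast_nonneg _
  nlinarith

theorem Hypergraph.one_le_rank (H : Hypergraph n m) (hm : 0 < m) : 1 ≤ H.rank :=
  (H.edge_nonempty ⟨0, hm⟩).card_pos.trans_le
    (Finset.le_sup (f := fun e => (H.edge e).card) (Finset.mem_univ _))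

theorem Hypergraph.one_le_maxDegree (H : Hypergraph n m) (hm : 0 < m) : 1 ≤ H.maxDegree := by
  obtain ⟨v, hv⟩ := H.edge_nonempty ⟨0, hm⟩
  refine le_trans ?_ (Finset.le_sup (f := H.degree) (Finset.mem_univ v))
  exact Finset.card_pos.2 ⟨⟨0, hm⟩, by simpa [Hypergraph.incident] using hv⟩

theorem round_time_le (H : Hypergraph n m) (hm : 0 < m) :
    ((29 * Nat.clog 2 H.maxDegree + 58 * Nat.clog 2 H.rank + 271 : ℕ) : ℝ) ≤
      400 * (1 + Real.log H.maxDegree + Real.log H.rank) := by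
  have h1 := clog_le_log (H.one_le_maxDegree hm)
  have h2 := clog_le_log (H.one_le_rank hm)
  have h3 : 0 ≤ Real.log H.maxDegree := Real.log_natCast_nonneg _
  have h4 : 0 ≤ Real.log H.rank := Real.log_natCast_nonneg _
  push_cast
  linarith

/-- Every round is free of write conflicts and takes logarithmic time and linear work. -/
theorem round_bounds (I : Lists H) (ξ : ℕ → PE → ℝ) (k : ℕ) (hm : 0 < m) :
    ∃ c c' : Config, run I ξ k = some c ∧ run I ξ (k + 1) = some c' ∧
      (c'.time : ℝ) - c.time ≤ 1425 * (1 + Real.log H.maxDegree + Real.log H.rank) ∧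
      (c'.work : ℝ) - c.work ≤ 1425 * (H.kappa + n) := by
  obtain ⟨c, hc, ⟨av, ae, ha, hinv⟩, -, -⟩ := exists_run I ξ k
  obtain ⟨c', hc', -, -, -, ht, hw⟩ := loopBody_spec ξ ha hinv
  refine ⟨c, c', hc, by rw [run, hc]; exact hc', ?_, ?_⟩
  · have h1 := round_time_le H hm
    have h2 : (c'.time : ℝ) ≤ c.time +
        (29 * Nat.clog 2 H.maxDegree + 58 * Nat.clog 2 H.rank + 271 : ℕ) := by exact_mod_cast ht
    have h3 : 0 ≤ Real.log H.maxDegree := Real.log_natCast_nonneg _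
    have h4 : 0 ≤ Real.log H.rank := Real.log_natCast_nonneg _
    linarith
  · have h2 : (c'.work : ℝ) ≤ c.work + 1425 * (H.kappa + n) := by exact_mod_cast hw
    linarith

/-! ### The local-max process on a conflict graph -/

section LocalMax

variable {ι : Type*}

/-- `f` belongs to `S` and has a greater weight than all other elements of `S` in conflict with
it. -/
def IsLocalMax (r : ι → ι → Prop) (S : Finset ι) (w : ι → ℝ) (f : ι) : Prop :=
  f ∈ S ∧ ∀ g ∈ S, r f g → g ≠ f → w g < w f

open Classical in
/-- One round of local-max: the local maxima and all elements in conflict with them are removed. -/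
noncomputable def localMaxStep (r : ι → ι → Prop) (S : Finset ι) (w : ι → ℝ) : Finset ι :=
  S.filter fun e => ¬ ∃ f, IsLocalMax r S w f ∧ r f e

/-- The remaining elements after `k` rounds, where `w k` are the weights in round `k`. -/
noncomputable def localMaxProcess [Fintype ι] (r : ι → ι → Prop) (w : ℕ → ι → ℝ) : ℕ → Finset ι
  | 0 => Finset.univ
  | k + 1 => localMaxStep r (localMaxProcess r w k) (w k)

theorem mem_localMaxStep {r : ι → ι → Prop} {S : Finset ι} {w : ι → ℝ} {e : ι} :
    e ∈ localMaxStep r S w ↔ e ∈ S ∧ ¬ ∃ f, IsLocalMax r S w f ∧ r f e := by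
  simp only [localMaxStep, Finset.mem_filter]

end LocalMax

variable {ξ : ℕ → PE → ℝ}

/-! ### The machine performs the local-max process -/

/-- Two hyperedges are in conflict if they have a common vertex. -/
def Hypergraph.Meets (H : Hypergraph n m) (e f : Fin m) : Prop := ∃ v, v ∈ H.edge e ∧ v ∈ H.edge f

/-- The weights of the hyperedges in round `k`. -/
def edgeWeight (m : ℕ) (ξ : ℕ → PE → ℝ) (k : ℕ) (e : Fin m) : ℝ := ξ k ⟨.edge, e + 1, 0⟩

/-- The state after `k` rounds if the weights of each round are distinct and non-negative: the active
hyperedges are those of the local-max process, and all their vertices are still in the loop and not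
marked as newly completed. -/
structure SimInv (I : Lists H) (av ae : ℕ → Prop) (ξ : ℕ → PE → ℝ) (k : ℕ) (s : State) : Prop where
  loopInv : LoopInv I av ae s
  calls : s.calls = k
  wt_zero : s.wt 0 = -1
  active : ∀ e : Fin m, ae (e + 1) ↔ e ∈ localMaxProcess H.Meets (edgeWeight m ξ) k
  of_active : ∀ e v, ae e → v ∈ I.erow e → av v ∧ s.mem .vNew v 0 = 0
  vNew_of_vInactive : ∀ v, s.mem .vInactive v 0 ≠ 0 → s.mem .vNew v 0 ≠ 0

theorem Lists.succ_mem_erow (I : Lists H) {u : Fin n} {f : Fin m} :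
    (u : ℕ) + 1 ∈ I.erow (f + 1) ↔ u ∈ H.edge f := by
  rw [I.mem_erow]
  constructor
  · rintro ⟨u', f', h1, h2, h3⟩
    have hu : u = u' := Fin.ext (by omega)
    have hf : f = f' := Fin.ext (by omega)
    rwa [hu, hf]
  · exact fun h => ⟨u, f, rfl, rfl, h⟩

section Round

variable {k : ℕ} {s s' : State}

/-- The top hyperedge of a vertex of an active hyperedge is its heaviest active hyperedge; it is not
`0`, as the weight `-1` of the latter is below all random numbers. -/
theorem SimInv.top (hs : SimInv I av ae ξ k s) (h : RoundSpec I av ae ξ s s')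
    (hnn : ∀ k e, 0 ≤ edgeWeight m ξ k e) {e : Fin m} {v : Fin n} (he : ae (e + 1))
    (hv : v ∈ H.edge e) :
    ∃ t : Fin m, s'.mem .top (v + 1) 0 = t + 1 ∧ v ∈ H.edge t ∧ ae (t + 1) ∧
      ∀ g : Fin m, ae (g + 1) → v ∈ H.edge g → edgeWeight m ξ k g ≤ edgeWeight m ξ k t := by
  have hwt : ∀ g : Fin m, ae (g + 1) → s'.wt (g + 1) = edgeWeight m ξ k g := fun g hg => by
    rw [h.wt, if_pos ⟨⟨by omega, by omega⟩, hg⟩, hs.calls]; rfl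
  have hwt0 : s'.wt 0 = -1 := by rw [h.wt, if_neg (by omega), hs.wt_zero]
  have hve := I.succ_mem_erow.2 hv
  have hav := (hs.of_active _ _ he hve).1
  have hact : ∀ g : Fin m, ae (g + 1) → s.mem .eInactive (g + 1) 0 = 0 := fun g hg =>
    (hs.loopInv.active_iff _ ⟨by omega, by omega⟩).1 hg
  have hmax : ∀ g : Fin m, ae (g + 1) → v ∈ H.edge g →
      edgeWeight m ξ k g ≤ s'.wt (s'.mem .top (v + 1) 0) := fun g hg hvg => by
    rw [← hwt g hg]
    exact h.top_max _ ⟨by omega, by omega⟩ hav _ (I.mem_erow_iff.1 (I.succ_mem_erow.2 hvg))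
      (hact g hg)
  have hne : s'.mem .top (v + 1) 0 ≠ 0 := by
    intro h0
    have h1 := hmax e he hv
    rw [h0, hwt0] at h1
    linarith [hnn k e]
  obtain ⟨h1, h2⟩ := h.top_mem _ ⟨by omega, by omega⟩ hav hne
  obtain ⟨u, t, hu, ht, hut⟩ := I.mem_vrow.1 h1
  have huv : v = u := Fin.ext (by omega)
  subst huv
  have hae : ae (t + 1) := (hs.loopInv.active_iff _ ⟨by omega, by omega⟩).2 (by rwa [← ht])
  refine ⟨t, ht, hut, hae, fun g hg hvg => ?_⟩
  rw [← hwt t hae, ← ht]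
  exact hmax g hg hvg

theorem SimInv.eNew_iff (hs : SimInv I av ae ξ k s) (h : RoundSpec I av ae ξ s s')
    (hnn : ∀ k e, 0 ≤ edgeWeight m ξ k e) (hinj : ∀ k, Function.Injective (edgeWeight m ξ k))
    {f : Fin m} {v : Fin n} (hav : av (v + 1)) (hv : v ∈ H.edge f) :
    s'.mem .eNew (f + 1) 0 ≠ 0 ↔
      IsLocalMax H.Meets (localMaxProcess H.Meets (edgeWeight m ξ) k) (edgeWeight m ξ k) f := by
  have hold : ¬ s.mem .eNew (f + 1) 0 ≠ 0 := fun h0 =>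
    hs.loopInv.left_of_completed _ _ (I.succ_mem_erow.2 hv) h0 hav
  have h1 : s'.mem .eNew (f + 1) 0 ≠ 0 ↔
      ae (f + 1) ∧ ∀ v ∈ I.erow (f + 1), s'.mem .top v 0 = f + 1 := by
    rw [h.eNew]
    split_ifs with h0
    · exact ⟨fun _ => h0.2, fun _ => one_ne_zero⟩
    · exact ⟨fun h1 => absurd h1 hold, fun h1 => absurd ⟨⟨by omega, by omega⟩, h1⟩ h0⟩
  rw [h1]
  constructor
  · rintro ⟨hf, htop⟩
    refine ⟨(hs.active f).1 hf, ?_⟩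
    rintro g hg ⟨u, huf, hug⟩ hgf
    obtain ⟨t, ht, -, -, hmax⟩ := hs.top h hnn hf huf
    have : t = f := by
      have := htop _ (I.succ_mem_erow.2 huf)
      exact Fin.ext (by omega)
    subst this
    exact (hmax g ((hs.active g).2 hg) hug).lt_of_ne fun heq => hgf (hinj k heq)
  · rintro ⟨hf, hmax⟩
    have hf' := (hs.active f).2 hf
    refine ⟨hf', fun u hu => ?_⟩
    obtain ⟨u, f', rfl, hff', huf⟩ := I.mem_erow.1 hu
    have : f = f' := Fin.ext (by omega)
    subst this
    obtain ⟨t, ht, hut, hta, htmax⟩ := hs.top h hnn hf' huf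
    by_cases htf : t = f
    · rw [ht, htf]
    · exact absurd (htmax f hf' huf) (not_le.2 (hmax t ((hs.active t).1 hta) ⟨u, huf, hut⟩ htf))

theorem SimInv.vNew_iff (hs : SimInv I av ae ξ k s) (h : RoundSpec I av ae ξ s s')
    (hnn : ∀ k e, 0 ≤ edgeWeight m ξ k e) (hinj : ∀ k, Function.Injective (edgeWeight m ξ k))
    {e : Fin m} {v : Fin n} (he : ae (e + 1)) (hv : v ∈ H.edge e) :
    s'.mem .vNew (v + 1) 0 ≠ 0 ↔ ∃ f, IsLocalMax H.Meets
      (localMaxProcess H.Meets (edgeWeight m ξ) k) (edgeWeight m ξ k) f ∧ v ∈ H.edge f := by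
  obtain ⟨hav, hold⟩ := hs.of_active _ _ he (I.succ_mem_erow.2 hv)
  have h1 : s'.mem .vNew (v + 1) 0 ≠ 0 ↔
      ∃ f ∈ I.vrow (v + 1), s'.mem .eNew f 0 ≠ 0 := by
    rw [h.vNew]
    split_ifs with h0
    · exact ⟨fun _ => h0.2, fun _ => one_ne_zero⟩
    · exact ⟨fun h1 => absurd hold h1, fun h1 => absurd ⟨hav, h1⟩ h0⟩
  rw [h1]
  constructor
  · rintro ⟨f, hf, hne⟩
    obtain ⟨u, f, huv, rfl, huf⟩ := I.mem_vrow.1 hf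
    have : v = u := Fin.ext (by omega)
    subst this
    exact ⟨f, (hs.eNew_iff h hnn hinj hav huf).1 hne, huf⟩
  · rintro ⟨f, hf, hvf⟩
    exact ⟨f + 1, I.mem_erow_iff.1 (I.succ_mem_erow.2 hvf),
      (hs.eNew_iff h hnn hinj hav hvf).2 hf⟩

theorem SimInv.next (hs : SimInv I av ae ξ k s) (h : RoundSpec I av ae ξ s s')
    (hnn : ∀ k e, 0 ≤ edgeWeight m ξ k e) (hinj : ∀ k, Function.Injective (edgeWeight m ξ k))
    (hinv : LoopInv I (vertexStays av s') (edgeStays ae s') s') :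
    SimInv I (vertexStays av s') (edgeStays ae s') ξ (k + 1) s' where
  loopInv := hinv
  calls := by rw [h.calls, hs.calls]
  wt_zero := by rw [h.wt, if_neg (by omega), hs.wt_zero]
  active e := by
    rw [localMaxProcess, mem_localMaxStep, ← hs.active, edgeStays]
    refine and_congr_right fun he => ?_
    rw [← not_iff_not, not_not, ← ne_eq, h.eInactive]
    have hact : s.mem .eInactive (e + 1) 0 = 0 :=
      (hs.loopInv.active_iff _ ⟨by omega, by omega⟩).1 he
    constructor
    · rintro (h0 | ⟨-, -, v, hv, hne⟩)
      · exact absurd hact h0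
      · obtain ⟨u, e', rfl, hee', hu⟩ := I.mem_erow.1 hv
        have : e = e' := Fin.ext (by omega)
        subst this
        obtain ⟨f, hf, huf⟩ := (hs.vNew_iff h hnn hinj he hu).1 hne
        exact ⟨f, hf, u, huf, hu⟩
    · rintro ⟨f, hf, u, huf, hue⟩
      exact Or.inr ⟨⟨by omega, by omega⟩, he, u + 1, I.succ_mem_erow.2 hue,
        (hs.vNew_iff h hnn hinj he hue).2 ⟨f, hf, huf⟩⟩
  of_active e v := by
    rintro ⟨he, he0⟩ hv
    obtain ⟨hav, hold⟩ := hs.of_active e v he hv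
    have hbounds := I.bounds_of_mem_vrow (I.mem_erow_iff.1 hv)
    have hnew : s'.mem .vNew v 0 = 0 := by
      by_contra hne
      exact (h.eInactive e).2 (Or.inr ⟨hbounds.2, he, v, hv, hne⟩) he0
    refine ⟨⟨hav, ?_, ?_⟩, hnew⟩
    · by_contra hne
      rcases (h.vInactive v).1 hne with h0 | ⟨-, -, h0⟩
      · exact hs.vNew_of_vInactive v h0 hold
      · exact h0 hnew
    · obtain ⟨u, f, rfl, rfl, huf⟩ := I.mem_erow.1 hv
      obtain ⟨t, ht, -⟩ := hs.top h hnn he huf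
      omega
  vNew_of_vInactive v hne := by
    rcases (h.vInactive v).1 hne with h0 | ⟨-, -, h0⟩
    · rw [h.vNew]
      split_ifs
      · exact one_ne_zero
      · exact hs.vNew_of_vInactive v h0
    · exact h0

end Round

theorem exists_run_simInv (I : Lists H) (hnn : ∀ k e, 0 ≤ edgeWeight m ξ k e)
    (hinj : ∀ k, Function.Injective (edgeWeight m ξ k)) (k : ℕ) :
    ∃ c, run I ξ k = some c ∧ ∃ av ae, c.alive = loopPEs I av ae ∧ SimInv I av ae ξ k c.st := by
  induction k with
  | zero =>
    obtain ⟨c, hc, ha, hwt, hcalls, hmem, -, -⟩ := run_zero I ξ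
    refine ⟨c, hc, _, _, ha, loopInv_of_initState hmem, hcalls, by rw [hwt], ?_, ?_, ?_⟩
    · simp [localMaxProcess]
    · intro e v _ _
      exact ⟨trivial, by rw [hmem _ (by decide)]; rfl⟩
    · intro v hv
      rw [hmem _ (by decide)] at hv
      exact absurd rfl hv
  | succ k ih =>
    obtain ⟨c, hc, av, ae, ha, hinv⟩ := ih
    obtain ⟨c', hc', ha', hinv', hspec, -, -⟩ := loopBody_spec ξ ha hinv.loopInv
    exact ⟨c', by rw [run, hc]; exact hc', _, _, ha', hinv.next hspec hnn hinj hinv'⟩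

/-- One round after the last hyperedge has become inactive no PE is left in the loop: the remaining
vertices need this round for finding that they have no active hyperedge. -/
theorem run_halts (I : Lists H) (hnn : ∀ k e, 0 ≤ edgeWeight m ξ k e)
    (hinj : ∀ k, Function.Injective (edgeWeight m ξ k)) {k : ℕ}
    (hk : localMaxProcess H.Meets (edgeWeight m ξ) k = ∅) :
    ∃ c, run I ξ (k + 1) = some c ∧ c.alive = ∅ ∧ ∀ e : Fin m, c.st.mem .eInactive (e + 1) 0 ≠ 0 := by
  obtain ⟨c, hc, av, ae, ha, hinv⟩ := exists_run_simInv I hnn hinj k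
  obtain ⟨c', hc', ha', hinv', hspec, -, -⟩ := loopBody_spec ξ ha hinv.loopInv
  have hae : ∀ e, 1 ≤ e ∧ e ≤ m → ¬ ae e := by
    intro e he h
    have := (hinv.active ⟨e - 1, by omega⟩).1 (by simpa [Nat.sub_add_cancel he.1] using h)
    rw [hk] at this
    exact absurd this (Finset.notMem_empty _)
  have hav : ∀ v, 1 ≤ v ∧ v ≤ n → ¬ vertexStays av c'.st v := by
    rintro v hv ⟨hav, -, htop⟩
    obtain ⟨h1, h2⟩ := hspec.top_mem v hv hav htop.ne'
    have hb := (I.bounds_of_mem_vrow h1).2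
    exact hae _ hb ((hinv.loopInv.active_iff _ hb).2 h2)
  refine ⟨c', by rw [run, hc]; exact hc', ?_, fun e => ?_⟩
  · rw [ha', Finset.eq_empty_iff_forall_notMem]
    rintro ⟨K, i, j⟩ hp
    rw [mem_loopPEs] at hp
    obtain ⟨hidx, hown⟩ := hp
    cases K
    · exact hav i hidx.1 hown
    · exact hae i hidx.1 hown.1
    · exact hav i (I.bounds_of_mem_vrow (List.getElem_mem (h := hidx))).1 hown
    · exact hae i (I.bounds_of_mem_vrow (I.mem_erow_iff.1 (List.getElem_mem (h := hidx)))).2 hown.1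
  · intro h0
    exact hae (e + 1) ⟨by omega, by omega⟩
      ((hinv'.active_iff _ ⟨by omega, by omega⟩).2 h0).1

/-! ### Independent weights with a common atomless law -/

section Weights

variable {ι Ω : Type*} [MeasurableSpace Ω] {μ : Measure Ω} [IsProbabilityMeasure μ]

theorem measure_eq_eq_zero {X Y : Ω → ℝ} (hX : Measurable X) (hY : Measurable Y)
    (hXY : IndepFun X Y μ) [NullSingletonClass (μ.map Y)] : μ {ω | X ω = Y ω} = 0 := by
  have h1 := (indepFun_iff_map_prod_eq_prod_map_map hX.aemeasurable hY.aemeasurable).1 hXY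
  have hd : MeasurableSet {p : ℝ × ℝ | p.1 = p.2} :=
    measurableSet_eq_fun measurable_fst measurable_snd
  have h2 : μ {ω | X ω = Y ω} = (μ.map fun ω => (X ω, Y ω)) {p : ℝ × ℝ | p.1 = p.2} := by
    rw [Measure.map_apply (hX.prodMk hY) hd]; rfl
  have : IsProbabilityMeasure (μ.map Y) := Measure.isProbabilityMeasure_map hY.aemeasurable
  rw [h2, h1, Measure.measure_prod_null hd]
  refine Filter.Eventually.of_forall fun x => ?_
  have : Prod.mk x ⁻¹' {p : ℝ × ℝ | p.1 = p.2} = {x} := by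
    ext y; simp [eq_comm]
  simp [this]

theorem measurableSet_isMax {W : ι → Ω → ℝ} (hW : ∀ i, Measurable (W i)) (T : Finset ι) (f : ι) :
    MeasurableSet {ω | ∀ g ∈ T, g ≠ f → W g ω < W f ω} := by
  simp only [Set.ofPred_forall]
  exact T.measurableSet_biInter fun g _ => MeasurableSet.iInter fun _ =>
    measurableSet_lt (hW g) (hW f)

/-- By symmetry each of the members of `T` is the heaviest one with the same probability, and
almost surely one of them is. -/
theorem measureReal_isMax [Fintype ι] {W : ι → Ω → ℝ} {ν : Measure ℝ} [NullSingletonClass ν]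
    (hW : ∀ i, Measurable (W i)) (hind : iIndepFun W μ) (hν : ∀ i, μ.map (W i) = ν)
    {T : Finset ι} {f : ι} (hf : f ∈ T) :
    μ.real {ω | ∀ g ∈ T, g ≠ f → W g ω < W f ω} = (T.card : ℝ)⁻¹ := by
  classical
  set E : ι → Set Ω := fun f => {ω | ∀ g ∈ T, g ≠ f → W g ω < W f ω} with hE
  have hEm : ∀ f, MeasurableSet (E f) := measurableSet_isMax hW T
  have hsymm : ∀ f' ∈ T, μ.real (E f') = μ.real (E f) := by
    intro f' hf'
    set σ : Equiv.Perm ι := Equiv.swap f f' with hσ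
    have hσT : ∀ g ∈ T, σ g ∈ T := by
      intro g hg
      rw [hσ, Equiv.swap_apply_def]
      split_ifs <;> assumption
    -- the weights permuted by `σ` are independent with the same laws, hence equally distributed
    have hlaw : μ.map (fun ω i => W (σ i) ω) = μ.map (fun ω i => W i ω) := by
      rw [(iIndepFun_iff_map_fun_eq_pi_map fun i => (hW i).aemeasurable).1 hind,
        (iIndepFun_iff_map_fun_eq_pi_map (f := fun i => W (σ i))
          fun i => (hW (σ i)).aemeasurable).1 (hind.precomp σ.injective)]
      simp only [hν]
    have hB : MeasurableSet {x : ι → ℝ | ∀ g ∈ T, g ≠ f → x g < x f} :=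
      measurableSet_isMax (W := fun i (x : ι → ℝ) => x i) (fun i => measurable_pi_apply i) T f
    have h1 : E f = (fun ω i => W i ω) ⁻¹' {x : ι → ℝ | ∀ g ∈ T, g ≠ f → x g < x f} := rfl
    have h2 : E f' = (fun ω i => W (σ i) ω) ⁻¹' {x : ι → ℝ | ∀ g ∈ T, g ≠ f → x g < x f} := by
      ext ω
      have hσf : σ f = f' := Equiv.swap_apply_left _ _
      simp only [hE, Set.mem_ofPred_eq, Set.mem_preimage, hσf]
      constructor
      · intro h g hg hgf
        exact h _ (hσT g hg) fun h' => hgf (σ.injective (h'.trans hσf.symm))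
      · intro h g hg hgf
        have := h (σ g) (hσT g hg) fun h' => hgf (by
          rw [← hσf, ← h', hσ, Equiv.swap_apply_self])
        rwa [hσ, Equiv.swap_apply_self] at this
    rw [h1, h2, measureReal_def, measureReal_def,
      ← Measure.map_apply (measurable_pi_lambda _ fun i => hW i) hB,
      ← Measure.map_apply (measurable_pi_lambda _ fun i => hW (σ i)) hB, hlaw]
  have hdisj : (T : Set ι).PairwiseDisjoint E := by
    intro a ha b hb hab
    rw [Function.onFun, Set.disjoint_left]
    intro ω h1 h2
    exact lt_asymm (h1 b hb hab.symm) (h2 a ha hab)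
  have hunion : μ.real (⋃ a ∈ T, E a) = 1 := by
    rw [measureReal_def, (prob_compl_eq_zero_iff (T.measurableSet_biUnion fun a _ => hEm a)).1,
      ENNReal.toReal_one]
    refine measure_mono_null (t := ⋃ a ∈ T, ⋃ b ∈ T, ⋃ _ : a ≠ b, {ω | W a ω = W b ω}) ?_ ?_
    · intro ω hω
      obtain ⟨a, ha, hmax⟩ := T.exists_max_image (fun i => W i ω) ⟨f, hf⟩
      have : ω ∉ E a := fun h => hω (Set.mem_biUnion (Finset.mem_coe.2 ha) h)
      simp only [hE, Set.mem_ofPred_eq, not_forall, not_lt] at this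
      obtain ⟨b, hb, hba, hle⟩ := this
      simp only [Set.mem_iUnion]
      exact ⟨a, ha, b, hb, hba.symm, le_antisymm hle (hmax b hb)⟩
    · refine (measure_biUnion_null_iff T.countable_toSet).2 fun a _ =>
        (measure_biUnion_null_iff T.countable_toSet).2 fun b _ => measure_iUnion_null fun hab => ?_
      have : NullSingletonClass (μ.map (W b)) := by rw [hν]; infer_instance
      exact measure_eq_eq_zero (hW a) (hW b) (hind.indepFun hab)
  rw [measureReal_biUnion_finset hdisj fun a _ => hEm a, Finset.sum_congr rfl hsymm,
    Finset.sum_const, nsmul_eq_mul] at hunion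
  exact eq_inv_of_mul_eq_one_right hunion

end Weights

/-! ### The expected progress of a round -/

section Progress

variable {ι : Type*} {r : ι → ι → Prop}

open Classical in
/-- The elements of `S` in conflict with `e`, including `e` itself if `r` is reflexive. -/
noncomputable def nbhd (r : ι → ι → Prop) (S : Finset ι) (e : ι) : Finset ι := S.filter (r e)

theorem mem_nbhd {S : Finset ι} {e f : ι} : f ∈ nbhd r S e ↔ f ∈ S ∧ r e f := by
  simp only [nbhd, Finset.mem_filter]

/-- The number of ordered conflicts within `S`, the potential function of the analysis. -/
noncomputable def conflicts (r : ι → ι → Prop) (S : Finset ι) : ℕ := ∑ e ∈ S, (nbhd r S e).card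

theorem localMaxStep_subset (S : Finset ι) (w : ι → ℝ) : localMaxStep r S w ⊆ S :=
  fun _ he => (mem_localMaxStep.1 he).1

theorem conflicts_le_sum {S S' : Finset ι} (h : S' ⊆ S) :
    conflicts r S' ≤ ∑ e ∈ S', (nbhd r S e).card :=
  Finset.sum_le_sum fun _ _ => Finset.card_le_card fun _ hf =>
    mem_nbhd.2 ⟨h (mem_nbhd.1 hf).1, (mem_nbhd.1 hf).2⟩

theorem one_le_conflicts (hrefl : ∀ e, r e e) {S : Finset ι} (hS : S.Nonempty) :
    1 ≤ conflicts r S := by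
  obtain ⟨e, he⟩ := hS
  exact (Finset.card_pos.2 ⟨e, mem_nbhd.2 ⟨he, hrefl e⟩⟩).trans_le
    (Finset.single_le_sum (f := fun e => (nbhd r S e).card) (fun _ _ => Nat.zero_le _) he)

theorem conflicts_le_card_sq (S : Finset ι) : conflicts r S ≤ S.card ^ 2 := by
  rw [sq, ← smul_eq_mul]
  exact Finset.sum_le_card_nsmul _ _ _ fun e _ => Finset.card_le_card fun f hf => (mem_nbhd.1 hf).1

/-- The sum over all ordered conflicts `(e, f)` of the share of `e` in the sum of the two degrees is
half of the number of conflicts. -/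
theorem sum_share (hrefl : ∀ e, r e e) (hsymm : ∀ e f, r e f → r f e) (S : Finset ι) :
    ∑ e ∈ S, ∑ f ∈ nbhd r S e, ((nbhd r S e).card : ℝ) *
      ((nbhd r S e).card + (nbhd r S f).card : ℝ)⁻¹ = (conflicts r S : ℝ) / 2 := by
  classical
  set F : ι → ι → ℝ := fun e f => ((nbhd r S e).card : ℝ) *
    ((nbhd r S e).card + (nbhd r S f).card : ℝ)⁻¹ with hF
  have hswap : ∑ e ∈ S, ∑ f ∈ nbhd r S e, F e f = ∑ e ∈ S, ∑ f ∈ nbhd r S e, F f e := by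
    refine Finset.sum_comm' fun e f => ?_
    simp only [mem_nbhd]
    exact ⟨fun ⟨h1, h2, h3⟩ => ⟨⟨h1, hsymm _ _ h3⟩, h2⟩, fun ⟨⟨h1, h3⟩, h2⟩ => ⟨h1, h2, hsymm _ _ h3⟩⟩
  have hsum : ∑ e ∈ S, ∑ f ∈ nbhd r S e, F e f + ∑ e ∈ S, ∑ f ∈ nbhd r S e, F f e =
      conflicts r S := by
    rw [← Finset.sum_add_distrib, conflicts, Nat.cast_sum]
    refine Finset.sum_congr rfl fun e he => ?_
    rw [← Finset.sum_add_distrib, Finset.card_eq_sum_ones, Nat.cast_sum]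
    refine Finset.sum_congr rfl fun f hf => ?_
    have hpos : 0 < (nbhd r S e).card := Finset.card_pos.2 ⟨e, mem_nbhd.2 ⟨he, hrefl e⟩⟩
    have hpos' : (0 : ℝ) < (nbhd r S e).card + (nbhd r S f).card := by positivity
    simp only [hF]
    rw [add_comm ((nbhd r S f).card : ℝ), ← add_mul, mul_inv_cancel₀ hpos'.ne', Nat.cast_one]
  linarith

variable {Ω : Type*} [MeasurableSpace Ω] {μ : Measure Ω} [IsProbabilityMeasure μ]

theorem measurableSet_mem_localMaxStep [Fintype ι] {W : ι → Ω → ℝ} (hW : ∀ i, Measurable (W i))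
    (S : Finset ι) (e : ι) : MeasurableSet {ω | e ∈ localMaxStep r S fun i => W i ω} := by
  have h : {ω | e ∈ localMaxStep r S fun i => W i ω} = {_ω | e ∈ S} ∩
      (⋃ f, {_ω | f ∈ S ∧ r f e} ∩ {ω | ∀ g ∈ nbhd r S f, g ≠ f → W g ω < W f ω})ᶜ := by
    ext ω
    simp only [Set.mem_ofPred_eq, mem_localMaxStep, IsLocalMax, Set.mem_inter_iff, Set.mem_compl_iff,
      Set.mem_iUnion, mem_nbhd, and_imp]
    exact and_congr_right fun _ => not_congr (exists_congr fun f => by tauto)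
  rw [h]
  exact (MeasurableSet.const _).inter (MeasurableSet.iUnion fun f =>
    (MeasurableSet.const _).inter (measurableSet_isMax hW _ f)).compl

/-- The probability that `e` is removed is at least that of the disjoint events that some `f` in
conflict with `e` is heavier than everything in conflict with `e` or `f`. -/
theorem sum_le_measureReal_removed [Fintype ι] (hsymm : ∀ e f, r e f → r f e)
    {W : ι → Ω → ℝ} {ν : Measure ℝ} [NullSingletonClass ν] (hW : ∀ i, Measurable (W i))
    (hind : iIndepFun W μ) (hν : ∀ i, μ.map (W i) = ν) (S : Finset ι) (e : ι) :
    ∑ f ∈ nbhd r S e, ((nbhd r S e).card + (nbhd r S f).card : ℝ)⁻¹ ≤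
      1 - μ.real {ω | e ∈ localMaxStep r S fun i => W i ω} := by
  classical
  set E : ι → Set Ω := fun f =>
    {ω | ∀ g ∈ nbhd r S e ∪ nbhd r S f, g ≠ f → W g ω < W f ω} with hE
  have hEm : ∀ f, MeasurableSet (E f) := fun f => measurableSet_isMax hW _ f
  have hdisj : (nbhd r S e : Set ι).PairwiseDisjoint E := by
    intro a ha b hb hab
    rw [Function.onFun, Set.disjoint_left]
    intro ω h1 h2
    exact lt_asymm (h1 b (Finset.mem_union_left _ hb) hab.symm)
      (h2 a (Finset.mem_union_left _ ha) hab)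
  have hsub : (⋃ f ∈ nbhd r S e, E f) ⊆ {ω | e ∈ localMaxStep r S fun i => W i ω}ᶜ := by
    intro ω hω
    simp only [Set.mem_iUnion] at hω
    obtain ⟨f, hf, hmax⟩ := hω
    have hf' := mem_nbhd.1 hf
    intro hmem
    exact (mem_localMaxStep.1 hmem).2 ⟨f, ⟨hf'.1, fun g hg hfg hgf =>
      hmax g (Finset.mem_union_right _ (mem_nbhd.2 ⟨hg, hfg⟩)) hgf⟩, hsymm _ _ hf'.2⟩
  calc ∑ f ∈ nbhd r S e, ((nbhd r S e).card + (nbhd r S f).card : ℝ)⁻¹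
      ≤ ∑ f ∈ nbhd r S e, μ.real (E f) := by
        refine Finset.sum_le_sum fun f hf => ?_
        rw [hE, measureReal_isMax hW hind hν (Finset.mem_union_left _ hf)]
        have hpos : 0 < (nbhd r S e ∪ nbhd r S f).card :=
          Finset.card_pos.2 ⟨f, Finset.mem_union_left _ hf⟩
        gcongr
        exact_mod_cast Finset.card_union_le _ _
    _ = μ.real (⋃ f ∈ nbhd r S e, E f) := (measureReal_biUnion_finset hdisj fun f _ => hEm f).symm
    _ ≤ μ.real {ω | e ∈ localMaxStep r S fun i => W i ω}ᶜ := measureReal_mono hsub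
    _ = _ := probReal_compl_eq_one_sub (measurableSet_mem_localMaxStep hW S e)

/-- The expected number of ordered conflicts whose first element survives the round is at most half
of all ordered conflicts. -/
theorem expected_degrees_le [Fintype ι] (hrefl : ∀ e, r e e) (hsymm : ∀ e f, r e f → r f e)
    {W : ι → Ω → ℝ} {ν : Measure ℝ} [NullSingletonClass ν] (hW : ∀ i, Measurable (W i))
    (hind : iIndepFun W μ) (hν : ∀ i, μ.map (W i) = ν) (S : Finset ι) :
    ∑ e ∈ S, ((nbhd r S e).card : ℝ) * μ.real {ω | e ∈ localMaxStep r S fun i => W i ω} ≤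
      (conflicts r S : ℝ) / 2 := by
  have h1 : ∑ e ∈ S, ∑ f ∈ nbhd r S e, ((nbhd r S e).card : ℝ) *
      ((nbhd r S e).card + (nbhd r S f).card : ℝ)⁻¹ ≤
      ∑ e ∈ S, ((nbhd r S e).card : ℝ) *
        (1 - μ.real {ω | e ∈ localMaxStep r S fun i => W i ω}) := by
    refine Finset.sum_le_sum fun e _ => ?_
    rw [← Finset.mul_sum]
    exact mul_le_mul_of_nonneg_left
      (sum_le_measureReal_removed hsymm hW hind hν S e) (Nat.cast_nonneg _)
  rw [sum_share hrefl hsymm] at h1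
  simp only [mul_sub, mul_one, Finset.sum_sub_distrib] at h1
  have h2 : ∑ e ∈ S, ((nbhd r S e).card : ℝ) = conflicts r S := by rw [conflicts, Nat.cast_sum]
  linarith

theorem sum_measureReal_inter_fiber {α : Type*} [Fintype α] {F : Ω → α}
    (hF : ∀ a, MeasurableSet {ω | F ω = a}) {B : Set Ω} (hB : MeasurableSet B) :
    ∑ a, μ.real ({ω | F ω = a} ∩ B) = μ.real B := by
  rw [← measureReal_iUnion_fintype (fun a b hab => ?_) (fun a => (hF a).inter hB)]
  · congr 1
    ext ω
    simp
  · rw [Function.onFun, Set.disjoint_left]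
    rintro ω ⟨h1, -⟩ ⟨h2, -⟩
    exact hab (h1.symm.trans h2)

theorem measurableSet_localMaxStep_eq [Fintype ι] {W : ι → Ω → ℝ} (hW : ∀ i, Measurable (W i))
    (S S' : Finset ι) : MeasurableSet {ω | (localMaxStep r S fun i => W i ω) = S'} := by
  simp only [Finset.ext_iff, Set.ofPred_forall]
  refine MeasurableSet.iInter fun e => ?_
  have hm := measurableSet_mem_localMaxStep (r := r) hW S e
  by_cases he : e ∈ S'
  · simpa only [he, iff_true] using hm
  · have : {ω | (e ∈ localMaxStep r S fun i => W i ω) ↔ e ∈ S'} =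
        {ω | e ∈ localMaxStep r S fun i => W i ω}ᶜ := by
      ext ω; simp [he]
    rw [this]
    exact hm.compl

/-- A round halves the expected number of conflicts. -/
theorem expected_conflicts_step [Fintype ι] (hrefl : ∀ e, r e e) (hsymm : ∀ e f, r e f → r f e)
    {W : ι → Ω → ℝ} {ν : Measure ℝ} [NullSingletonClass ν] (hW : ∀ i, Measurable (W i))
    (hind : iIndepFun W μ) (hν : ∀ i, μ.map (W i) = ν) (S : Finset ι) :
    ∑ S', μ.real {ω | (localMaxStep r S fun i => W i ω) = S'} * (conflicts r S' : ℝ) ≤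
      (conflicts r S : ℝ) / 2 := by
  classical
  refine le_trans ?_ (expected_degrees_le hrefl hsymm hW hind hν S)
  have hterm : ∀ S' : Finset ι,
      μ.real {ω | (localMaxStep r S fun i => W i ω) = S'} * (conflicts r S' : ℝ) ≤
      ∑ e ∈ S, ((nbhd r S e).card : ℝ) * μ.real ({ω | (localMaxStep r S fun i => W i ω) = S'} ∩
        {ω | e ∈ localMaxStep r S fun i => W i ω}) := by
    intro S'
    by_cases hS' : S' ⊆ S
    · calc μ.real {ω | (localMaxStep r S fun i => W i ω) = S'} * (conflicts r S' : ℝ)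
          ≤ μ.real {ω | (localMaxStep r S fun i => W i ω) = S'} *
            ∑ e ∈ S', ((nbhd r S e).card : ℝ) := by
            gcongr
            exact_mod_cast conflicts_le_sum hS'
        _ = ∑ e ∈ S', ((nbhd r S e).card : ℝ) *
              μ.real ({ω | (localMaxStep r S fun i => W i ω) = S'} ∩
                {ω | e ∈ localMaxStep r S fun i => W i ω}) := by
            rw [Finset.mul_sum]
            refine Finset.sum_congr rfl fun e he => ?_
            rw [mul_comm, Set.inter_eq_left.2]
            intro ω hω
            have hω' : (localMaxStep r S fun i => W i ω) = S' := hω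
            change e ∈ localMaxStep r S fun i => W i ω
            rwa [hω']
        _ ≤ _ := Finset.sum_le_sum_of_subset_of_nonneg hS' fun e _ _ => by positivity
    · have : {ω | (localMaxStep r S fun i => W i ω) = S'} = ∅ := by
        rw [Set.eq_empty_iff_forall_notMem]
        intro ω hω
        exact hS' ((show (localMaxStep r S fun i => W i ω) = S' from hω) ▸ localMaxStep_subset _ _)
      simp [this]
  refine (Finset.sum_le_sum fun S' _ => hterm S').trans (le_of_eq ?_)
  rw [Finset.sum_comm]
  refine Finset.sum_congr rfl fun e _ => ?_
  rw [← Finset.mul_sum, sum_measureReal_inter_fiber (fun S' => measurableSet_localMaxStep_eq hW S S')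
    (measurableSet_mem_localMaxStep hW S e)]

end Progress

/-! ### The number of rounds -/

section Rounds

variable {ι Ω : Type*} {r : ι → ι → Prop}

/-- The information in the random numbers of the rounds in `J`. -/
@[reducible] def roundsSigma (X : ℕ → ι → Ω → ℝ) (J : Set ℕ) : MeasurableSpace Ω :=
  ⨆ q ∈ {q : ℕ × ι | q.1 ∈ J}, MeasurableSpace.comap (X q.1 q.2) inferInstance

theorem measurable_roundsSigma (X : ℕ → ι → Ω → ℝ) {J : Set ℕ} {k : ℕ} (hk : k ∈ J) (i : ι) :
    Measurable[roundsSigma X J] (X k i) := by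
  rw [measurable_iff_comap_le]
  exact le_iSup₂_of_le (f := fun (q : ℕ × ι) (_ : q ∈ {q : ℕ × ι | q.1 ∈ J}) =>
    MeasurableSpace.comap (X q.1 q.2) inferInstance) (k, i) hk le_rfl

theorem roundsSigma_mono (X : ℕ → ι → Ω → ℝ) {J J' : Set ℕ} (h : J ⊆ J') :
    roundsSigma X J ≤ roundsSigma X J' :=
  biSup_mono fun _ hq => h hq

theorem localMaxProcess_succ_eq [Fintype ι] (X : ℕ → ι → Ω → ℝ) (k : ℕ) (S' : Finset ι) :
    {ω | localMaxProcess r (fun k i => X k i ω) (k + 1) = S'} =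
      ⋃ S, {ω | localMaxProcess r (fun k i => X k i ω) k = S} ∩
        {ω | (localMaxStep r S fun i => X k i ω) = S'} := by
  ext ω
  simp [localMaxProcess]

/-- The process after `k` rounds depends on the weights of the first `k` rounds only. -/
theorem measurableSet_localMaxProcess_eq [Fintype ι] (X : ℕ → ι → Ω → ℝ) (k : ℕ) :
    ∀ S, MeasurableSet[roundsSigma X (Set.Iio k)]
      {ω | localMaxProcess r (fun k i => X k i ω) k = S} := by
  induction k with
  | zero => intro S; exact @MeasurableSet.const _ (roundsSigma X (Set.Iio 0)) (Finset.univ = S)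
  | succ k ih =>
    intro S'
    rw [localMaxProcess_succ_eq]
    let _ := roundsSigma X (Set.Iio (k + 1))
    exact MeasurableSet.iUnion fun S => MeasurableSet.inter
      (roundsSigma_mono X (Set.Iio_subset_Iio (Nat.le_succ k)) _ (ih S))
      (measurableSet_localMaxStep_eq
        (fun i => measurable_roundsSigma X (Set.mem_Iio.2 (Nat.lt_succ_self k)) i) S S')

variable [MeasurableSpace Ω] {μ : Measure Ω} [IsProbabilityMeasure μ] {X : ℕ → ι → Ω → ℝ}

theorem roundsSigma_le (hX : ∀ k i, Measurable (X k i)) (J : Set ℕ) :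
    roundsSigma X J ≤ ‹MeasurableSpace Ω› :=
  iSup₂_le fun q _ => (hX q.1 q.2).comap_le

/-- The transition probabilities of the process: the weights of a round are independent of the
past. -/
theorem measureReal_localMaxProcess_succ [Fintype ι] (hX : ∀ k i, Measurable (X k i))
    (hind : iIndepFun (fun q : ℕ × ι => X q.1 q.2) μ) (k : ℕ) (S' : Finset ι) :
    μ.real {ω | localMaxProcess r (fun k i => X k i ω) (k + 1) = S'} =
      ∑ S, μ.real {ω | localMaxProcess r (fun k i => X k i ω) k = S} *
        μ.real {ω | (localMaxStep r S fun i => X k i ω) = S'} := by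
  have hpast : ∀ S, MeasurableSet {ω | localMaxProcess r (fun k i => X k i ω) k = S} :=
    fun S => roundsSigma_le hX _ _ (measurableSet_localMaxProcess_eq X k S)
  have hindep : Indep (roundsSigma X (Set.Iio k)) (roundsSigma X {k}) μ := by
    refine indep_iSup_of_disjoint (m := fun q : ℕ × ι => MeasurableSpace.comap (X q.1 q.2) inferInstance)
      (S := {q | q.1 ∈ Set.Iio k}) (T := {q | q.1 ∈ ({k} : Set ℕ)})
      (fun q => (hX q.1 q.2).comap_le) hind.iIndep ?_
    rw [Set.disjoint_left]
    rintro q h1 h2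
    exact (ne_of_lt (Set.mem_Iio.1 h1)) (Set.mem_singleton_iff.1 h2)
  rw [localMaxProcess_succ_eq, measureReal_iUnion_fintype (fun a b hab => ?_)
    (fun S => (hpast S).inter (measurableSet_localMaxStep_eq (hX k) S S'))]
  · refine Finset.sum_congr rfl fun S _ => ?_
    have := (Indep_iff _ _ μ).1 hindep _ _ (measurableSet_localMaxProcess_eq (r := r) X k S)
      (@measurableSet_localMaxStep_eq _ r _ (roundsSigma X {k}) _ _
        (fun i => measurable_roundsSigma X (Set.mem_singleton k) i) S S')
    rw [measureReal_def, this, ENNReal.toReal_mul]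
    rfl
  · rw [Function.onFun, Set.disjoint_left]
    rintro ω ⟨h1, -⟩ ⟨h2, -⟩
    exact hab (h1.symm.trans h2)

theorem expected_conflicts_le [Fintype ι] (hrefl : ∀ e, r e e) (hsymm : ∀ e f, r e f → r f e)
    {ν : Measure ℝ} [NullSingletonClass ν] (hX : ∀ k i, Measurable (X k i))
    (hind : iIndepFun (fun q : ℕ × ι => X q.1 q.2) μ) (hν : ∀ k i, μ.map (X k i) = ν) (k : ℕ) :
    ∑ S, μ.real {ω | localMaxProcess r (fun k i => X k i ω) k = S} * (conflicts r S : ℝ) ≤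
      (Fintype.card ι : ℝ) ^ 2 / 2 ^ k := by
  classical
  induction k with
  | zero =>
    rw [Finset.sum_eq_single Finset.univ]
    · have h1 : (conflicts r (Finset.univ : Finset ι) : ℝ) ≤ (Fintype.card ι : ℝ) ^ 2 := by
        exact_mod_cast conflicts_le_card_sq (r := r) (Finset.univ : Finset ι)
      simpa [localMaxProcess] using h1
    · intro S _ hS
      simp [localMaxProcess, hS.symm]
    · simp
  | succ k ih =>
    calc ∑ S', μ.real {ω | localMaxProcess r (fun k i => X k i ω) (k + 1) = S'} *
          (conflicts r S' : ℝ)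
        = ∑ S, μ.real {ω | localMaxProcess r (fun k i => X k i ω) k = S} *
            ∑ S', μ.real {ω | (localMaxStep r S fun i => X k i ω) = S'} * (conflicts r S' : ℝ) := by
          simp only [measureReal_localMaxProcess_succ hX hind, Finset.sum_mul, Finset.mul_sum]
          rw [Finset.sum_comm]
          simp only [mul_assoc]
      _ ≤ ∑ S, μ.real {ω | localMaxProcess r (fun k i => X k i ω) k = S} *
            ((conflicts r S : ℝ) / 2) := by
          gcongr with S
          exact expected_conflicts_step hrefl hsymm (hX k)
            (hind.precomp (g := fun i => (k, i)) fun i j h => (Prod.mk.inj h).2) (hν k) S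
      _ = (∑ S, μ.real {ω | localMaxProcess r (fun k i => X k i ω) k = S} *
            (conflicts r S : ℝ)) / 2 := by
          rw [Finset.sum_div]
          simp only [mul_div_assoc]
      _ ≤ (Fintype.card ι : ℝ) ^ 2 / 2 ^ k / 2 := by gcongr
      _ = _ := by rw [div_div, ← pow_succ]

/-- By Markov's inequality the process is empty with high probability after logarithmically many
rounds. -/
theorem measureReal_localMaxProcess_ne_empty_le [Fintype ι] (hrefl : ∀ e, r e e)
    (hsymm : ∀ e f, r e f → r f e) {ν : Measure ℝ} [NullSingletonClass ν] (hX : ∀ k i, Measurable (X k i))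
    (hind : iIndepFun (fun q : ℕ × ι => X q.1 q.2) μ) (hν : ∀ k i, μ.map (X k i) = ν) (k : ℕ) :
    μ.real {ω | localMaxProcess r (fun k i => X k i ω) k ≠ ∅} ≤
      (Fintype.card ι : ℝ) ^ 2 / 2 ^ k := by
  classical
  refine le_trans ?_ (expected_conflicts_le hrefl hsymm hX hind hν k)
  have hpast : ∀ S, MeasurableSet {ω | localMaxProcess r (fun k i => X k i ω) k = S} :=
    fun S => roundsSigma_le hX _ _ (measurableSet_localMaxProcess_eq X k S)
  rw [← sum_measureReal_inter_fiber hpast (B := {ω | localMaxProcess r (fun k i => X k i ω) k ≠ ∅})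
    (hpast ∅).compl]
  refine Finset.sum_le_sum fun S _ => ?_
  rcases S.eq_empty_or_nonempty with rfl | hS
  · have : {ω | localMaxProcess r (fun k i => X k i ω) k = ∅} ∩
        {ω | localMaxProcess r (fun k i => X k i ω) k ≠ ∅} = ∅ := by
      ext ω; simp
    rw [this, measureReal_empty]
    positivity
  · calc μ.real ({ω | localMaxProcess r (fun k i => X k i ω) k = S} ∩ _)
        ≤ μ.real {ω | localMaxProcess r (fun k i => X k i ω) k = S} :=
          measureReal_mono Set.inter_subset_left
      _ ≤ _ := le_mul_of_one_le_right measureReal_nonneg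
          (by exact_mod_cast one_le_conflicts hrefl hS)

end Rounds

/-! ### The machine with random numbers -/

theorem ae_nonneg_of_isUniform {Ω : Type*} [MeasurableSpace Ω] {μ : Measure Ω} {X : Ω → ℝ}
    (hX : pdf.IsUniform X (Set.Icc 0 1) μ volume) : ∀ᵐ ω ∂μ, 0 ≤ X ω := by
  have h := hX.measure_preimage (by simp) (by simp) (A := (Set.Icc 0 1)ᶜ)
    measurableSet_Icc.compl
  rw [Set.inter_compl_self, measure_empty, ENNReal.zero_div] at h
  refine measure_mono_null (fun ω hω => ?_) h
  exact fun h' => hω h'.1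

/-- Almost surely the hyperedges have distinct non-negative weights in every round, so that the
machine performs the local-max process, which ends within `k` rounds with high probability. -/
theorem measure_not_halts_le (I : Lists H) {Ω : Type*} [MeasurableSpace Ω] (μ : Measure Ω)
    [IsProbabilityMeasure μ] (ξ : ℕ → PE → Ω → ℝ) (hmeas : ∀ k p, Measurable (ξ k p))
    (hunif : ∀ k p, pdf.IsUniform (ξ k p) (Set.Icc 0 1) μ volume)
    (hind : iIndepFun (fun q : ℕ × PE => ξ q.1 q.2) μ) (k : ℕ) :
    μ {ω | ¬ ∃ c, run I (fun k p => ξ k p ω) (k + 1) = some c ∧ c.alive = ∅ ∧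
        ∀ e : Fin m, c.st.mem .eInactive (e + 1) 0 ≠ 0} ≤
      ENNReal.ofReal ((m : ℝ) ^ 2 / 2 ^ k) := by
  set X : ℕ → Fin m → Ω → ℝ := fun k e => ξ k ⟨.edge, e + 1, 0⟩ with hXdef
  have hX : ∀ k e, Measurable (X k e) := fun k e => hmeas _ _
  have hinj : Function.Injective
      fun q : ℕ × Fin m => ((q.1, ⟨.edge, q.2 + 1, 0⟩) : ℕ × PE) := by
    rintro ⟨k, e⟩ ⟨k', e'⟩ h
    simp only [Prod.mk.injEq, PE.mk.injEq, true_and, and_true, Nat.add_right_cancel_iff] at h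
    exact Prod.ext h.1 (Fin.ext h.2)
  have hindX : iIndepFun (fun q : ℕ × Fin m => X q.1 q.2) μ := hind.precomp hinj
  set ν : Measure ℝ := ProbabilityTheory.cond volume (Set.Icc (0 : ℝ) 1) with hνdef
  have hν : ∀ k e, μ.map (X k e) = ν := fun k e => hunif _ _
  have : NullSingletonClass ν :=
    ⟨fun x => ProbabilityTheory.cond_absolutelyContinuous (measure_singleton x)⟩
  have hnn : ∀ᵐ ω ∂μ, ∀ k e, 0 ≤ X k e ω :=
    ae_all_iff.2 fun k => ae_all_iff.2 fun e => ae_nonneg_of_isUniform (hunif _ _)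
  have hdist : ∀ᵐ ω ∂μ, ∀ k e f, e ≠ f → X k e ω ≠ X k f ω := by
    refine ae_all_iff.2 fun k => ae_all_iff.2 fun e => ae_all_iff.2 fun f => ?_
    by_cases hef : e = f
    · exact Filter.Eventually.of_forall fun ω h => absurd hef h
    · have : NullSingletonClass (μ.map (X k f)) := by rw [hν]; infer_instance
      have h0 := measure_eq_eq_zero (hX k e) (hX k f)
        (hindX.indepFun (i := (k, e)) (j := (k, f)) fun h => hef (Prod.mk.inj h).2)
      exact measure_mono_null (fun ω hω => by_contra fun h => hω fun _ => h) h0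
  have hbound := measureReal_localMaxProcess_ne_empty_le (μ := μ) (r := H.Meets) (X := X)
    (fun e => let ⟨v, hv⟩ := H.edge_nonempty e; ⟨v, hv, hv⟩)
    (fun e f ⟨v, h1, h2⟩ => ⟨v, h2, h1⟩) hX hindX hν k
  rw [Fintype.card_fin] at hbound
  refine (measure_mono_ae ?_).trans
    ((ENNReal.le_ofReal_iff_toReal_le (measure_ne_top _ _) (by positivity)).2 hbound)
  filter_upwards [hnn, hdist] with ω h1 h2 hω hne
  exact hω (run_halts (ξ := fun k p => ξ k p ω) I h1 (fun k e f h => by_contra fun hef => h2 k e f hef h)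
    hne)

/-- A number of rounds that makes the failure probability polynomially small. -/
theorem exists_rounds {a : ℝ} (ha : 0 < a) {m : ℕ} (hm : 0 < m) :
    ∃ k : ℕ, (m : ℝ) ^ 2 / 2 ^ k ≤ (m : ℝ) ^ (-a) ∧
      ((k + 1 : ℕ) : ℝ) ≤ 2 * (a + 2) * (1 + Real.log m) := by
  have hm' : (0 : ℝ) < m := by exact_mod_cast hm
  have hlog : 0 ≤ Real.log m := Real.log_natCast_nonneg m
  have hl2 : 0 < Real.log 2 := Real.log_pos one_lt_two
  refine ⟨⌈(a + 2) * Real.log m / Real.log 2⌉₊, ?_, ?_⟩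
  · set k := ⌈(a + 2) * Real.log m / Real.log 2⌉₊
    have hk : (a + 2) * Real.log m / Real.log 2 ≤ k := Nat.le_ceil _
    rw [div_le_iff₀ hl2] at hk
    rw [div_le_iff₀ (by positivity)]
    have h1 : (m : ℝ) ^ (a + 2) ≤ 2 ^ k := by
      rw [← Real.log_le_log_iff (by positivity) (by positivity), Real.log_rpow hm', Real.log_pow]
      exact hk
    calc (m : ℝ) ^ 2 = (m : ℝ) ^ (-a) * (m : ℝ) ^ (a + 2) := by
          rw [← Real.rpow_add hm', ← Real.rpow_natCast]
          congr 1
          push_cast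
          ring
      _ ≤ _ := by gcongr
  · have hk := (Nat.ceil_lt_add_one (a := (a + 2) * Real.log m / Real.log 2) (by positivity)).le
    have h2 : (a + 2) * Real.log m / Real.log 2 ≤ 2 * ((a + 2) * Real.log m) := by
      rw [div_le_iff₀ hl2]
      have := Real.log_two_gt_d9
      have h3 : 0 ≤ (a + 2) * Real.log m := by positivity
      nlinarith
    push_cast
    linarith

end CREW

theorem mainTheorem4 :
    -- every single round, for all inputs and all random numbers
    (∃ C : ℝ, 0 < C ∧
      ∀ (n m : ℕ) (H : CREW.Hypergraph n m) (I : CREW.Lists H) (ξ : ℕ → CREW.PE → ℝ) (k : ℕ),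
        0 < m →
        ∃ c c' : CREW.Config, CREW.run I ξ k = some c ∧ CREW.run I ξ (k + 1) = some c' ∧
          (c'.time : ℝ) - c.time ≤ C * (1 + Real.log H.maxDegree + Real.log H.rank) ∧
          (c'.work : ℝ) - c.work ≤ C * (H.kappa + n)) ∧
    -- the whole run, with high probability
    (∀ a : ℝ, 0 < a → ∃ C : ℝ, 0 < C ∧
      ∀ (n m : ℕ) (H : CREW.Hypergraph n m) (I : CREW.Lists H)
        {Ω : Type*} [MeasurableSpace Ω] (μ : Measure Ω) [IsProbabilityMeasure μ]
        (ξ : ℕ → CREW.PE → Ω → ℝ),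
        0 < m →
        (∀ k p, Measurable (ξ k p)) →
        (∀ k p, pdf.IsUniform (ξ k p) (Set.Icc 0 1) μ volume) →
        iIndepFun (fun q : ℕ × CREW.PE => ξ q.1 q.2) μ →
        μ {ω | ¬ CREW.HaltsWithin I (fun k p => ξ k p ω)
              (C * (1 + Real.log m))
              (C * ((1 + Real.log H.maxDegree + Real.log H.rank) * (1 + Real.log m)))
              (C * ((H.kappa + n) * (1 + Real.log m)))}
          ≤ ENNReal.ofReal ((m : ℝ) ^ (-a))) := by
  refine ⟨⟨1425, by norm_num, fun n m H I ξ k hm => CREW.round_bounds I ξ k hm⟩, fun a ha => ?_⟩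
  refine ⟨12 + 1425 * (2 * (a + 2)), by positivity, ?_⟩
  intro n m H I Ω _ μ _ ξ hm hmeas hunif hind
  obtain ⟨k, hprob, hk⟩ := CREW.exists_rounds ha hm
  refine (measure_mono fun ω hω => ?_).trans ((CREW.measure_not_halts_le I μ ξ hmeas hunif hind
    k).trans (ENNReal.ofReal_le_ofReal hprob))
  rintro ⟨c, hc, halive, hact⟩
  refine hω ⟨k + 1, c, hc, halive, hact, ?_⟩
  obtain ⟨c', hc', -, ht, hw⟩ := CREW.exists_run I (fun k p => ξ k p ω) (k + 1)
  obtain rfl : c = c' := Option.some.inj (hc.symm.trans hc')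
  set R : ℝ := 2 * (a + 2) with hR
  have hR0 : 0 < R := by positivity
  have hlogm : 0 ≤ Real.log m := Real.log_natCast_nonneg m
  have hlogs : 0 ≤ Real.log H.maxDegree + Real.log H.rank :=
    add_nonneg (Real.log_natCast_nonneg _) (Real.log_natCast_nonneg _)
  have hB := CREW.round_time_le H hm
  set B : ℕ := 29 * Nat.clog 2 H.maxDegree + 58 * Nat.clog 2 H.rank + 271
  set D : ℝ := 1 + Real.log H.maxDegree + Real.log H.rank with hD
  have hD1 : 1 ≤ D := by linarith
  have ht' : (c.time : ℝ) ≤ 4 + ((k + 1 : ℕ) : ℝ) * B := by exact_mod_cast ht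
  have hw' : (c.work : ℝ) ≤ 12 * (H.kappa + n) + ((k + 1 : ℕ) : ℝ) * (1425 * (H.kappa + n)) := by
    exact_mod_cast hw
  have hW : (0 : ℝ) ≤ H.kappa + n := by positivity
  refine ⟨?_, ?_, ?_⟩
  · refine hk.trans ?_
    gcongr
    linarith
  · have h1 : ((k + 1 : ℕ) : ℝ) * B ≤ (R * (1 + Real.log m)) * (400 * D) := by gcongr
    have h2 : 1 ≤ D * (1 + Real.log m) := one_le_mul_of_one_le_of_one_le hD1 (by linarith)
    have h3 : R * (D * (1 + Real.log m)) ≥ 0 := by positivity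
    linarith
  · have h1 : ((k + 1 : ℕ) : ℝ) * (1425 * (H.kappa + n)) ≤
        (R * (1 + Real.log m)) * (1425 * (H.kappa + n)) := by gcongr
    have h2 : ((H.kappa : ℝ) + n) * 1 ≤ (H.kappa + n) * (1 + Real.log m) := by
      gcongr
      linarith
    linarith
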